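/- For a function $f:\mathbb R\to\mathbb R$ with locally absolutely continuous derivative put $\psi(f)=\int_{\mathbb R} f''(x)^2\,dx$, and for a probability measure $\mu$ on $\mathbb R$ put $(f*\mu)(y)=\int f(y-e)\,d\mu(e)$ (this is $f*f_e$ if $\mu$ has density $f_e$). There are functions $C_1,C_2:\mathbb R^2\to(0,\infty)$ such that the following holds. Let $l<u$, and let $f_x$ be a differentiable probability density on $\mathbb R$ which vanishes outside $[l,u]$, satisfies $f_x(l)=f_x'(l)=f_x(u)=f_x'(u)=0$, and is twice continuously differentiable on $[l,u]$. Let $\mu$ be any probability measure on $\mathbb R$ (the known error distribution), and $f_y=f_x*\mu$. Let $Y_j=X_j+\epsilon_j$, $j\ge 1$, where the pairs $(X_j,\epsilon_j)$ are independent, $X_j$ has density $f_x$, $\epsilon_j$ has distribution $\mu$, and $X_j,\epsilon_j$ are independent. Write $C_i=C_i(\psi(f_x),\psi(f_y))$ and $$\lambda_n=C_1\,n^{7/8}(\log n)^{1/8}\sqrt{|u-l|}.$$ A penalised maximum likelihood estimate (P-MLE) from $Y_1,\dots,Y_n$ is a minimiser of $$J(f)=-\sum_{i=1}^n\log\big((f*\mu)(Y_i)\big)+\lambda_n\,\psi(f)$$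 over all differentiable probability densities $f$ on $\mathbb R$ that vanish outside $[l,u]$, satisfy $f(l)=f'(l)=f(u)=f'(u)=0$, have $f'$ absolutely continuous with $f''\in L^2$, and satisfy $(f*\mu)(Y_i)>0$ for $i=1,\dots,n$. Then, almost surely, for all sufficiently large $n$, a P-MLE exists and every P-MLE $\hat f_x$ satisfies $$\|\hat f_x*\mu-f_y\|_\infty< C_2\,n^{-1/32}\,|u-l|^{1/8}\,(\log n)^{1/32}.$$ -/

import Mathlib

open MeasureTheory ProbabilityTheory Filter
open scoped ENNReal Topology

noncomputable section

namespace Deconvolution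

/-- The smoothness penalty `ψ(f) = ∫ f''(x)² dx`. For a function supported in `[l, u]` the integral
over the line is the integral over `[l, u]`. For the functions considered below, `f'` is
locally absolutely continuous, so that `deriv (deriv f)` is the weak second derivative almost everywhere. -/
def psi (f : ℝ → ℝ) : ℝ := ∫ x, (deriv (deriv f) x) ^ 2

/-- The convolution `f * μ` of a function with the error distribution `μ`:
`y ↦ E_ε f(y - ε)`, where `ε` has law `μ`. If `μ` has density `f_e`, this is `f * f_e`. -/
def conv (f : ℝ → ℝ) (μ : Measure ℝ) (y : ℝ) : ℝ := ∫ e, f (y - e) ∂μ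

/-- The sup-norm on the line, with values in `[0, ∞]`. -/
def supNorm (g : ℝ → ℝ) : ℝ≥0∞ := ⨆ y, ‖g y‖ₑ

/-- `f` is a differentiable probability density on the line that vanishes outside `[l, u]` and
satisfies `f(l) = f'(l) = 0` and `f(u) = f'(u) = 0`. -/
structure IsDensityOn (l u : ℝ) (f : ℝ → ℝ) : Prop where
  differentiable : Differentiable ℝ f
  left : f l = 0
  deriv_left : deriv f l = 0
  right : f u = 0
  deriv_right : deriv f u = 0
  nonneg : ∀ x, 0 ≤ f x
  eq_zero : ∀ x, x ∉ Set.Icc l u → f x = 0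
  integral_eq_one : ∫ x, f x = 1

/-- The competitors in the penalised likelihood problem: all densities on `[l, u]` satisfying the
boundary conditions and having a weak second derivative in `L²`. -/
structure IsCandidate (l u : ℝ) (f : ℝ → ℝ) : Prop where
  isDensityOn : IsDensityOn l u f
  absCont : AbsolutelyContinuousOnInterval (deriv f) l u
  memLp : MemLp (deriv (deriv f)) 2 volume

/-- All `n` observations `y 0, …, y (n - 1)` have positive density under `f * μ`, so that the
log-likelihood of `f` is defined (otherwise it is `-∞`). -/
def PosLikelihood (μ : Measure ℝ) (n : ℕ) (y : ℕ → ℝ) (f : ℝ → ℝ) : Prop :=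
  ∀ i < n, 0 < conv f μ (y i)

/-- The penalised negative log-likelihood
`J(f) = - ∑_{i < n} log ((f * μ)(y i)) + lam * ψ(f)`. -/
def objective (μ : Measure ℝ) (lam : ℝ) (n : ℕ) (y : ℕ → ℝ) (f : ℝ → ℝ) : ℝ :=
  -(∑ i ∈ Finset.range n, Real.log (conv f μ (y i))) + lam * psi f

/-- `f` is a penalised maximum likelihood estimate on `[l, u]` from the observations
`y 0, …, y (n - 1)`, with error distribution `μ` and tuning parameter `lam`: it minimises `J`
among the candidates, where `J` is `+∞` at candidates under which some observation has density
zero. -/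
structure IsPMLE (l u : ℝ) (μ : Measure ℝ) (lam : ℝ) (n : ℕ) (y : ℕ → ℝ) (f : ℝ → ℝ) : Prop where
  isCandidate : IsCandidate l u f
  posLikelihood : PosLikelihood μ n y f
  minimal : ∀ g, IsCandidate l u g → PosLikelihood μ n y g →
    objective μ lam n y f ≤ objective μ lam n y g

/-- The tuning parameter `λ_n = C₁ n^{7/8} (log n)^{1/8} √|u - l|`. -/
def tuning (C₁ l u : ℝ) (n : ℕ) : ℝ :=
  C₁ * (n : ℝ) ^ (7 / 8 : ℝ) * Real.log n ^ (1 / 8 : ℝ) * √|u - l|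

/-- The rate `n^{-1/32} |u - l|^{1/8} (log n)^{1/32}`. -/
def rate (l u : ℝ) (n : ℕ) : ℝ :=
  (n : ℝ) ^ (-(1 / 32) : ℝ) * |u - l| ^ (1 / 8 : ℝ) * Real.log n ^ (1 / 32 : ℝ)

end Deconvolution

end

/-!
Write `g = fx * μ` for the density of the observations, `h = f * μ` for the density belonging to an
estimate `f`, and `r = rate l u n`, so that `tuning 1 l u n = n r⁴`. The constants `C₁ = C₂ = 1`
suffice, because the argument gives the bound `O(r ^ (4 / 3))` for the sup-norm, with a factor that
depends on `u - l` and `ψ(fx)` only, and `r → 0`.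

*Existence* (`exists_isPMLE`). The objective is convex, and by the parallelogram law for `ψ` it is
uniformly convex in `f''`. Hence the second derivatives along a minimising sequence converge in
`L²`, and the twofold primitive of their limit is a minimiser.

*Deviations* (`ae_eventually_sum_log_lt`). Minimality gives
`n r⁴ (ψ(f) - ψ(fx)) ≤ ∑ log (h / g)(Y i)`. For a fixed nonnegative function `H` in place of `h`,
the variable `∏ √(H / g)(Y i)` has mean at most `(∫ √(H g)) ^ n`, and `∫ √(H g)` is smaller than
`(∫ H + ∫ g) / 2` by at least a quarter of `discrimination H g = ∫ (H - g)² / (H + g)`. Markov's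
inequality, a union bound and the Borel-Cantelli lemma bound `∑ log (H / g)(Y i)` for finitely many
`H` at once; no moments of the logarithms are needed, so that `μ` may be arbitrary.

*Discretisation* (`exists_stepFun`). The functions `H` are the convolutions of step functions lying
above the estimate. As a candidate is Lipschitz with constant `√(ψ(f) (u - l))`
(`IsCandidate.abs_sub_le`), about `√n` steps suffice once `ψ(f)` is known to be at most of the order
`√n`. This first bound comes from `h ≤ sup f · (1_[l,u] * μ)`, where the convolved indicator
function is one more choice of `H` (`IsPMLE.penalty_le_of_indicator`). The logarithm of the number
of step functions is then of smaller order than `n r⁴`, and `IsPMLE.penalty_add_discrimination_le`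
yields `ψ(f) ≤ ψ(fx) + 1` and `discrimination H g = O(r⁴)`.

*Sup-norm* (`pow_three_le_discrimination`). Both `h` and `g` are Lipschitz, so a deviation `s` at
one point persists on an interval of length of order `s`, which contributes a multiple of `s³` to
the discrimination.
-/

noncomputable section

namespace Deconvolution

/-! ### Convolution with a probability measure -/

/-- `w` is measurable, takes values in `[0, A]` and vanishes outside `[l, u]`. -/
structure IsBoundedOn (l u A : ℝ) (w : ℝ → ℝ) : Prop where
  measurable : Measurable w
  nonneg : ∀ x, 0 ≤ w x
  le : ∀ x, w x ≤ A
  eq_zero : ∀ x, x ∉ Set.Icc l u → w x = 0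

section Conv

variable {l u A B : ℝ} {v w : ℝ → ℝ} {μ : Measure ℝ}

lemma IsBoundedOn.bound_nonneg (hw : IsBoundedOn l u A w) : 0 ≤ A :=
  (hw.nonneg 0).trans (hw.le 0)

lemma IsBoundedOn.integrable (hw : IsBoundedOn l u A w) : Integrable w := by
  have h : Integrable (Set.indicator (Set.Icc l u) fun _ : ℝ => A) :=
    (integrable_indicator_iff measurableSet_Icc).2 (integrableOn_const (by simp))
  refine h.mono' hw.measurable.aestronglyMeasurable (ae_of_all _ fun x => ?_)
  rw [Real.norm_of_nonneg (hw.nonneg x)]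
  by_cases hx : x ∈ Set.Icc l u
  · simpa [Set.indicator_of_mem hx] using hw.le x
  · simp [Set.indicator_of_notMem hx, hw.eq_zero x hx]

lemma IsBoundedOn.integrable_comp_sub [IsProbabilityMeasure μ] (hw : IsBoundedOn l u A w)
    (y : ℝ) : Integrable (fun e => w (y - e)) μ := by
  refine (integrable_const A).mono' (hw.measurable.comp (measurable_const.sub
    measurable_id)).aestronglyMeasurable (ae_of_all _ fun x => ?_)
  rw [Real.norm_of_nonneg (hw.nonneg _)]
  exact hw.le _

lemma conv_nonneg (hw : IsBoundedOn l u A w) (y : ℝ) : 0 ≤ conv w μ y :=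
  integral_nonneg fun _ => hw.nonneg _

lemma conv_le [IsProbabilityMeasure μ] (hw : IsBoundedOn l u A w) (y : ℝ) : conv w μ y ≤ A := by
  have := integral_mono (hw.integrable_comp_sub (μ := μ) y) (integrable_const A)
    fun e => hw.le (y - e)
  simpa [conv] using this

lemma measurable_conv [SFinite μ] (hw : Measurable w) : Measurable (conv w μ) := by
  have : StronglyMeasurable (Function.uncurry fun y e : ℝ => w (y - e)) :=
    (hw.comp (measurable_fst.sub measurable_snd)).stronglyMeasurable
  exact this.integral_prod_right.measurable

lemma conv_le_conv_add [IsProbabilityMeasure μ] (hv : IsBoundedOn l u A v)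
    (hw : IsBoundedOn l u B w) {c : ℝ} (h : ∀ x, v x ≤ w x + c) (y : ℝ) :
    conv v μ y ≤ conv w μ y + c := by
  have := integral_mono (hv.integrable_comp_sub (μ := μ) y)
    ((hw.integrable_comp_sub y).add (integrable_const c)) fun e => h (y - e)
  rw [integral_add' (hw.integrable_comp_sub y) (integrable_const c)] at this
  simpa [conv] using this

lemma conv_mono [IsProbabilityMeasure μ] (hv : IsBoundedOn l u A v)
    (hw : IsBoundedOn l u B w) (h : ∀ x, v x ≤ w x) (y : ℝ) : conv v μ y ≤ conv w μ y := by
  simpa using conv_le_conv_add (μ := μ) hv hw (c := 0) (by simpa using h) y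

lemma abs_conv_sub_conv_le [IsProbabilityMeasure μ] (hw : IsBoundedOn l u A w) {L : ℝ}
    (h : ∀ x y, |w x - w y| ≤ L * |x - y|) (x y : ℝ) :
    |conv w μ x - conv w μ y| ≤ L * |x - y| := by
  rw [conv, conv, ← integral_sub (hw.integrable_comp_sub x) (hw.integrable_comp_sub y)]
  have := norm_integral_le_of_norm_le_const (μ := μ) (C := L * |x - y|)
    (f := fun e => w (x - e) - w (y - e)) (ae_of_all _ fun e => by
      simpa using h (x - e) (y - e))
  simpa using this

/-- Convolution with a probability measure is the adjoint of the law of a sum: testing `w * μ`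
against `q` is the same as averaging `q (x + e)` over `w(x) dx` and `μ`. -/
lemma lintegral_mul_conv [IsProbabilityMeasure μ] (hw : IsBoundedOn l u A w) {q : ℝ → ℝ≥0∞}
    (hq : Measurable q) :
    ∫⁻ y, ENNReal.ofReal (conv w μ y) * q y
      = ∫⁻ e, ∫⁻ x, ENNReal.ofReal (w x) * q (x + e) ∂volume ∂μ := by
  have h1 : ∀ y, ENNReal.ofReal (conv w μ y) * q y
      = ∫⁻ e, ENNReal.ofReal (w (y - e)) * q y ∂μ := fun y => by
    rw [conv, ofReal_integral_eq_lintegral_ofReal (hw.integrable_comp_sub y)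
      (ae_of_all _ fun _ => hw.nonneg _), lintegral_mul_const]
    exact (hw.measurable.comp (measurable_const.sub measurable_id)).ennreal_ofReal
  simp_rw [h1]
  rw [lintegral_lintegral_swap]
  · refine lintegral_congr fun e => ?_
    have := lintegral_add_right_eq_self (μ := volume)
      (fun y => ENNReal.ofReal (w (y - e)) * q y) e
    rw [← this]
    simp
  · exact ((hw.measurable.comp (measurable_fst.sub measurable_snd)).ennreal_ofReal.mul
      (hq.comp measurable_fst)).aemeasurable

lemma lintegral_conv [IsProbabilityMeasure μ] (hw : IsBoundedOn l u A w) :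
    ∫⁻ y, ENNReal.ofReal (conv w μ y) = ∫⁻ x, ENNReal.ofReal (w x) := by
  simpa using lintegral_mul_conv (μ := μ) hw (q := fun _ => 1) measurable_const

lemma integrable_conv [IsProbabilityMeasure μ] (hw : IsBoundedOn l u A w) :
    Integrable (conv w μ) := by
  refine ⟨(measurable_conv hw.measurable).aestronglyMeasurable, ?_⟩
  rw [hasFiniteIntegral_iff_ofReal (ae_of_all _ fun y => conv_nonneg hw y), lintegral_conv hw]
  exact (hasFiniteIntegral_iff_ofReal (ae_of_all _ hw.nonneg)).1 hw.integrable.2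

lemma integral_conv [IsProbabilityMeasure μ] (hw : IsBoundedOn l u A w) :
    ∫ y, conv w μ y = ∫ x, w x := by
  rw [integral_eq_lintegral_of_nonneg_ae (ae_of_all _ fun y => conv_nonneg hw y)
    (measurable_conv hw.measurable).aestronglyMeasurable, lintegral_conv hw,
    integral_eq_lintegral_of_nonneg_ae (ae_of_all _ hw.nonneg)
      hw.measurable.aestronglyMeasurable]

end Conv

/-! ### A Hellinger-type inequality -/

/-- The defect of the arithmetic-geometric mean inequality, with the squared distance of the roots
replaced by a quotient without roots. -/
lemma sqrt_mul_le_sub_sq_div {a b : ℝ} (ha : 0 ≤ a) (hb : 0 ≤ b) :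
    √(a * b) ≤ (a + b) / 2 - (a - b) ^ 2 / (4 * (a + b)) := by
  rcases (add_nonneg ha hb).eq_or_lt with h | h
  · have h1 : a = 0 := by linarith
    have h2 : b = 0 := by linarith
    simp [h1, h2]
  · have key : (a + b) / 2 - (a - b) ^ 2 / (4 * (a + b))
        = ((a + b) ^ 2 + 4 * (a * b)) / (4 * (a + b)) := by
      field_simp; ring
    rw [key, le_div_iff₀ (by positivity)]
    have := Real.sq_sqrt (mul_nonneg ha hb)
    nlinarith [sq_nonneg (a + b - 2 * √(a * b))]

/-- The triangular discrimination `∫ (v - w)² / (v + w)`, a distance between nonnegative integrable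
functions which is equivalent to the squared Hellinger distance. Where both functions vanish, the
convention `0 / 0 = 0` gives the right value. -/
def discrimination (v w : ℝ → ℝ) : ℝ := ∫ y, (v y - w y) ^ 2 / (v y + w y)

lemma sub_sq_div_le_add {a b : ℝ} (ha : 0 ≤ a) (hb : 0 ≤ b) : (a - b) ^ 2 / (a + b) ≤ a + b :=
  div_le_of_le_mul₀ (by positivity) (by positivity) (by nlinarith [mul_nonneg ha hb])

lemma integrable_discrimination {v w : ℝ → ℝ} (hv : Integrable v) (hw : Integrable w)
    (mv : Measurable v) (mw : Measurable w) (hv0 : ∀ y, 0 ≤ v y) (hw0 : ∀ y, 0 ≤ w y) :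
    Integrable fun y => (v y - w y) ^ 2 / (v y + w y) := by
  refine (hv.add hw).mono' (((mv.sub mw).pow_const 2).div (mv.add mw)).aestronglyMeasurable
    (ae_of_all _ fun y => ?_)
  rw [Real.norm_of_nonneg (div_nonneg (sq_nonneg _) (add_nonneg (hv0 y) (hw0 y)))]
  exact sub_sq_div_le_add (hv0 y) (hw0 y)

lemma discrimination_nonneg {v w : ℝ → ℝ} (hv0 : ∀ y, 0 ≤ v y) (hw0 : ∀ y, 0 ≤ w y) :
    0 ≤ discrimination v w :=
  integral_nonneg fun y => div_nonneg (sq_nonneg _) (add_nonneg (hv0 y) (hw0 y))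

/-- A bound for the mean of `√(v / w)` under the density `w`. -/
lemma lintegral_mul_sqrt_div_le {v w : ℝ → ℝ} (hv : Integrable v) (hw : Integrable w)
    (mv : Measurable v) (mw : Measurable w) (hv0 : ∀ y, 0 ≤ v y) (hw0 : ∀ y, 0 ≤ w y) :
    ∫⁻ y, ENNReal.ofReal (w y) * ENNReal.ofReal √(v y / w y)
      ≤ ENNReal.ofReal (((∫ y, v y) + ∫ y, w y) / 2 - discrimination v w / 4) := by
  have hI := integrable_discrimination hv hw mv mw hv0 hw0
  have hS : Integrable fun y => (v y + w y) / 2 := (hv.add hw).div_const 2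
  have hval : ((∫ y, v y) + ∫ y, w y) / 2 - discrimination v w / 4
      = ∫ y, ((v y + w y) / 2 - (v y - w y) ^ 2 / (v y + w y) / 4) := by
    rw [integral_sub hS (hI.div_const 4), integral_div, integral_div,
      integral_add hv hw]
    rfl
  have hpt : ∀ y, √(v y * w y) ≤ (v y + w y) / 2 - (v y - w y) ^ 2 / (v y + w y) / 4 := fun y => by
    refine (sqrt_mul_le_sub_sq_div (hv0 y) (hw0 y)).trans_eq ?_
    rw [mul_comm 4, ← div_div]
  have hD : Integrable fun y => (v y + w y) / 2 - (v y - w y) ^ 2 / (v y + w y) / 4 :=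
    hS.sub (hI.div_const 4)
  rw [hval, ofReal_integral_eq_lintegral_ofReal hD
    (ae_of_all _ fun y => (Real.sqrt_nonneg _).trans (hpt y))]
  refine lintegral_mono fun y => ?_
  rw [← ENNReal.ofReal_mul (hw0 y)]
  refine ENNReal.ofReal_le_ofReal (le_trans ?_ (hpt y))
  rcases (hw0 y).eq_or_lt with h | h
  · simp [← h]
  · rw [Real.le_sqrt (by positivity) (mul_nonneg (hv0 y) (hw0 y)), mul_pow,
      Real.sq_sqrt (div_nonneg (hv0 y) (hw0 y))]
    field_simp
    exact le_rfl

/-- A lower bound for the discrimination: if `|v - w| ≥ s` on an interval of length `r` and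
`v + w ≤ B`, then it is at least `r s² / B`. -/
lemma le_discrimination {v w : ℝ → ℝ} (hv : Integrable v) (hw : Integrable w)
    (mv : Measurable v) (mw : Measurable w) (hv0 : ∀ y, 0 ≤ v y) (hw0 : ∀ y, 0 ≤ w y)
    {a r s B : ℝ} (hr : 0 ≤ r) (hs : 0 < s) (hB : ∀ y, v y + w y ≤ B)
    (h : ∀ y ∈ Set.Icc a (a + r), s ≤ |v y - w y|) :
    r * (s ^ 2 / B) ≤ discrimination v w := by
  have hI := integrable_discrimination hv hw mv mw hv0 hw0
  have h0 : ∀ y, 0 ≤ (v y - w y) ^ 2 / (v y + w y) := fun y =>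
    div_nonneg (sq_nonneg _) (add_nonneg (hv0 y) (hw0 y))
  calc r * (s ^ 2 / B) = ∫ _ in Set.Icc a (a + r), s ^ 2 / B := by simp [hr]
    _ ≤ ∫ y in Set.Icc a (a + r), (v y - w y) ^ 2 / (v y + w y) := by
        refine setIntegral_mono_on (integrableOn_const (by simp)) hI.integrableOn
          measurableSet_Icc fun y hy => ?_
        have h1 := h y hy
        have h2 : 0 < v y + w y := by
          rcases abs_cases (v y - w y) with h3 | h3 <;> linarith [hv0 y, hw0 y]
        have h4 : s ^ 2 ≤ (v y - w y) ^ 2 := by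
          rw [← sq_abs (v y - w y)]; gcongr
        have := hB y
        gcongr
    _ ≤ discrimination v w := setIntegral_le_integral hI (ae_of_all _ h0)

/-! ### Regularity of the candidates -/

lemma intervalIntegrable_of_memLp_two {q : ℝ → ℝ} (hq : MemLp q 2) (a b : ℝ) :
    IntervalIntegrable q volume a b :=
  intervalIntegrable_iff.2 (((hq.locallyIntegrable (by norm_num)).integrableOn_isCompact
    isCompact_uIcc).mono_set Set.uIoc_subset_uIcc)

/-- The Cauchy-Schwarz inequality against the constant `1`. -/
lemma sq_intervalIntegral_le {q : ℝ → ℝ} (hq : MemLp q 2) {a b : ℝ} (hab : a ≤ b) :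
    (∫ t in a..b, q t) ^ 2 ≤ (b - a) * ∫ t, q t ^ 2 := by
  rcases hab.eq_or_lt with rfl | hlt
  · simp
  have hsq : Integrable fun t => q t ^ 2 := hq.integrable_sq
  have hsqi : IntervalIntegrable (fun t => q t ^ 2) volume a b := hsq.intervalIntegrable
  have hi : IntervalIntegrable q volume a b := intervalIntegrable_of_memLp_two hq a b
  set I := ∫ t in a..b, q t
  -- the variance of `q` on `[a, b]` is nonnegative
  have hvar : 0 ≤ ∫ t in a..b, (q t - I / (b - a)) ^ 2 :=
    intervalIntegral.integral_nonneg hab fun t _ => sq_nonneg _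
  have hexp : ∫ t in a..b, (q t - I / (b - a)) ^ 2
      = (∫ t in a..b, q t ^ 2) - 2 * (I / (b - a)) * I + (b - a) * (I / (b - a)) ^ 2 := by
    have : ∀ t, (q t - I / (b - a)) ^ 2
        = (q t ^ 2 - 2 * (I / (b - a)) * q t) + (I / (b - a)) ^ 2 := fun t => by ring
    simp_rw [this]
    rw [intervalIntegral.integral_add (hsqi.sub (hi.const_mul _)) intervalIntegrable_const,
      intervalIntegral.integral_sub hsqi (hi.const_mul _), intervalIntegral.integral_const_mul,
      intervalIntegral.integral_const, smul_eq_mul]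
  have hle : ∫ t in a..b, q t ^ 2 ≤ ∫ t, q t ^ 2 := by
    rw [intervalIntegral.integral_of_le hab]
    exact setIntegral_le_integral hsq (ae_of_all _ fun t => sq_nonneg _)
  have hpos : 0 < b - a := sub_pos.2 hlt
  have h3 : (∫ t in a..b, q t ^ 2) - 2 * (I / (b - a)) * I + (b - a) * (I / (b - a)) ^ 2
      = (∫ t in a..b, q t ^ 2) - I ^ 2 / (b - a) := by
    field_simp; ring
  rw [hexp, h3, sub_nonneg, div_le_iff₀ hpos] at hvar
  nlinarith

lemma psi_nonneg (f : ℝ → ℝ) : 0 ≤ psi f := integral_nonneg fun _ => sq_nonneg _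

section Candidate

variable {l u : ℝ} {f g : ℝ → ℝ}

lemma eventually_notMem_Icc {x : ℝ} (hx : x ∉ Set.Icc l u) : ∀ᶠ y in 𝓝 x, y ∉ Set.Icc l u :=
  isClosed_Icc.isOpen_compl.mem_nhds hx

lemma IsDensityOn.deriv_eq_zero (hf : IsDensityOn l u f) {x : ℝ} (hx : x ∉ Set.Icc l u) :
    deriv f x = 0 := by
  have : f =ᶠ[𝓝 x] fun _ => 0 := (eventually_notMem_Icc hx).mono fun y hy => hf.eq_zero y hy
  simpa using this.deriv_eq

lemma IsDensityOn.deriv_deriv_eq_zero (hf : IsDensityOn l u f) {x : ℝ} (hx : x ∉ Set.Icc l u) :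
    deriv (deriv f) x = 0 := by
  have : deriv f =ᶠ[𝓝 x] fun _ => 0 :=
    (eventually_notMem_Icc hx).mono fun y hy => hf.deriv_eq_zero hy
  simpa using this.deriv_eq

lemma IsCandidate.deriv_eq_integral (hf : IsCandidate l u f) {x : ℝ} (hx : x ∈ Set.Icc l u) :
    deriv f x = ∫ t in l..x, deriv (deriv f) t := by
  have h : AbsolutelyContinuousOnInterval (deriv f) l x := hf.absCont.mono (by
    rw [Set.uIcc_of_le hx.1, Set.uIcc_of_le (hx.1.trans hx.2)]
    exact Set.Icc_subset_Icc_right hx.2)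
  rw [h.integral_deriv_eq_sub, hf.isDensityOn.deriv_left, sub_zero]

lemma IsCandidate.continuous_deriv (hf : IsCandidate l u f) (hlu : l < u) :
    Continuous (deriv f) := by
  have h1 : ContinuousOn (deriv f) (Set.Icc l u) := by
    simpa [Set.uIcc_of_le hlu.le] using hf.absCont.continuousOn
  have h2 : ∀ x ∉ Set.Ioo l u, deriv f x = 0 := fun x hx => by
    by_cases h : x ∈ Set.Icc l u
    · rcases h.1.eq_or_lt with rfl | h3
      · exact hf.isDensityOn.deriv_left
      · rcases h.2.eq_or_lt with rfl | h4
        · exact hf.isDensityOn.deriv_right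
        · exact absurd ⟨h3, h4⟩ hx
    · exact hf.isDensityOn.deriv_eq_zero h
  have h3 : ∀ {s : Set ℝ}, (∀ x ∈ s, x ∉ Set.Ioo l u) → ContinuousOn (deriv f) s := fun hs =>
    continuousOn_const.congr fun x hx => h2 x (hs x hx)
  rw [← continuousOn_univ]
  have h4 : (Set.univ : Set ℝ) = Set.Iic l ∪ Set.Icc l u ∪ Set.Ici u := by
    rw [Set.Iic_union_Icc_eq_Iic hlu.le, Set.Iic_union_Ici]
  rw [h4]
  exact ((h3 fun x hx h => hx.not_gt h.1).union_of_isClosed h1 isClosed_Iic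
    isClosed_Icc).union_of_isClosed (h3 fun x hx h => hx.not_gt h.2)
    (isClosed_Iic.union isClosed_Icc) isClosed_Ici

/-- The Lipschitz constant which the penalty provides. -/
lemma IsCandidate.abs_deriv_le (hf : IsCandidate l u f) (x : ℝ) :
    |deriv f x| ≤ √(psi f * (u - l)) := by
  by_cases hx : x ∈ Set.Icc l u
  · apply Real.abs_le_sqrt
    rw [hf.deriv_eq_integral hx]
    refine (sq_intervalIntegral_le hf.memLp hx.1).trans ?_
    have h1 : 0 ≤ psi f := psi_nonneg f
    have h2 := hx.2
    calc (x - l) * psi f ≤ (u - l) * psi f := by gcongr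
      _ = _ := mul_comm _ _
  · rw [hf.isDensityOn.deriv_eq_zero hx, abs_zero]
    exact Real.sqrt_nonneg _

lemma IsCandidate.abs_sub_le (hf : IsCandidate l u f) (x y : ℝ) :
    |f x - f y| ≤ √(psi f * (u - l)) * |x - y| := by
  have := convex_univ.norm_image_sub_le_of_norm_deriv_le (f := f) (x := y) (y := x)
    (fun z _ => hf.isDensityOn.differentiable z) (fun z _ => hf.abs_deriv_le z)
    (Set.mem_univ _) (Set.mem_univ _)
  simpa using this

lemma IsCandidate.isBoundedOn (hf : IsCandidate l u f) (hlu : l < u) :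
    IsBoundedOn l u (√(psi f * (u - l)) * (u - l)) f where
  measurable := hf.isDensityOn.differentiable.continuous.measurable
  nonneg := hf.isDensityOn.nonneg
  le x := by
    have h0 : 0 < u - l := sub_pos.2 hlu
    by_cases hx : x ∈ Set.Icc l u
    · have h := hf.abs_sub_le x l
      rw [hf.isDensityOn.left, sub_zero, abs_of_nonneg (sub_nonneg.2 hx.1)] at h
      refine ((le_abs_self _).trans h).trans ?_
      have := hx.2
      gcongr
    · rw [hf.isDensityOn.eq_zero x hx]; positivity
  eq_zero := hf.isDensityOn.eq_zero

/-- A density which is twice continuously differentiable on `[l, u]` is a candidate. -/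
lemma isCandidate_of_contDiffOn (hlu : l < u) (hf : IsDensityOn l u f)
    (h2 : ContDiffOn ℝ 2 f (Set.Icc l u)) : IsCandidate l u f := by
  have hud : UniqueDiffOn ℝ (Set.Icc l u) := uniqueDiffOn_Icc hlu
  have hd : ∀ x ∈ Set.Icc l u, derivWithin f (Set.Icc l u) x = deriv f x := fun x hx =>
    (hf.differentiable x).derivWithin (hud x hx)
  have hc : ContDiffOn ℝ 1 (deriv f) (Set.Icc l u) :=
    (h2.derivWithin hud (by norm_num : (1 : WithTop ℕ∞) + 1 ≤ 2)).congr fun x hx => (hd x hx).symm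
  refine ⟨hf, ContDiffOn.absolutelyContinuousOnInterval (by rwa [Set.uIcc_of_le hlu.le]), ?_⟩
  obtain ⟨K, hK⟩ := hc.exists_lipschitzOnWith (by decide) (convex_Icc _ _) isCompact_Icc
  have hbound : ∀ᵐ x, ‖deriv (deriv f) x‖ ≤ ‖Set.indicator (Set.Icc l u) (fun _ => (K : ℝ)) x‖ := by
    have h1 : ∀ᵐ x : ℝ, x ≠ l := by simp [ae_iff, measure_singleton]
    have h2 : ∀ᵐ x : ℝ, x ≠ u := by simp [ae_iff, measure_singleton]
    filter_upwards [h1, h2] with x hxl hxu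
    by_cases hx : x ∈ Set.Icc l u
    · rw [Set.indicator_of_mem hx]
      have : Set.Icc l u ∈ 𝓝 x :=
        Icc_mem_nhds (lt_of_le_of_ne hx.1 hxl.symm) (lt_of_le_of_ne hx.2 hxu)
      simpa using norm_deriv_le_of_lipschitzOn this hK
    · rw [hf.deriv_deriv_eq_zero hx]; simp
  exact (memLp_indicator_const 2 measurableSet_Icc (K : ℝ) (Or.inr (by simp))).mono
    (measurable_deriv _).aestronglyMeasurable hbound

/-! ### Midpoints of candidates -/

/-- The midpoint of two functions. -/
def midpointFun (f g : ℝ → ℝ) (x : ℝ) : ℝ := (f x + g x) / 2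

lemma IsCandidate.deriv_midpointFun (hf : IsCandidate l u f) (hg : IsCandidate l u g) :
    deriv (midpointFun f g) = midpointFun (deriv f) (deriv g) := by
  ext x
  exact (((hf.isDensityOn.differentiable x).hasDerivAt.add
    (hg.isDensityOn.differentiable x).hasDerivAt).div_const 2).deriv

lemma IsCandidate.deriv_deriv_midpointFun (hlu : l < u) (hf : IsCandidate l u f)
    (hg : IsCandidate l u g) : deriv (deriv (midpointFun f g))
      =ᵐ[volume] midpointFun (deriv (deriv f)) (deriv (deriv g)) := by
  rw [hf.deriv_midpointFun hg]
  filter_upwards [hf.absCont.ae_differentiableAt, hg.absCont.ae_differentiableAt] with x h1 h2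
  rw [Set.uIcc_of_le hlu.le] at h1 h2
  by_cases hx : x ∈ Set.Icc l u
  · exact (((h1 hx).hasDerivAt.add (h2 hx).hasDerivAt).div_const 2).deriv
  · have : midpointFun (deriv f) (deriv g) =ᶠ[𝓝 x] fun _ => 0 :=
      (eventually_notMem_Icc hx).mono fun y hy => by
        simp [midpointFun, hf.isDensityOn.deriv_eq_zero hy, hg.isDensityOn.deriv_eq_zero hy]
    rw [this.deriv_eq]
    simp [midpointFun, hf.isDensityOn.deriv_deriv_eq_zero hx,
      hg.isDensityOn.deriv_deriv_eq_zero hx]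

lemma IsCandidate.midpointFun (hlu : l < u) (hf : IsCandidate l u f) (hg : IsCandidate l u g) :
    IsCandidate l u (midpointFun f g) where
  isDensityOn :=
    { differentiable :=
        (hf.isDensityOn.differentiable.add hg.isDensityOn.differentiable).div_const 2
      left := by simp [Deconvolution.midpointFun, hf.isDensityOn.left, hg.isDensityOn.left]
      deriv_left := by
        simp [hf.deriv_midpointFun hg, Deconvolution.midpointFun, hf.isDensityOn.deriv_left,
          hg.isDensityOn.deriv_left]
      right := by simp [Deconvolution.midpointFun, hf.isDensityOn.right, hg.isDensityOn.right]
      deriv_right := by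
        simp [hf.deriv_midpointFun hg, Deconvolution.midpointFun, hf.isDensityOn.deriv_right,
          hg.isDensityOn.deriv_right]
      nonneg := fun x => by
        have := hf.isDensityOn.nonneg x
        have := hg.isDensityOn.nonneg x
        unfold Deconvolution.midpointFun
        positivity
      eq_zero := fun x hx => by
        simp [Deconvolution.midpointFun, hf.isDensityOn.eq_zero x hx, hg.isDensityOn.eq_zero x hx]
      integral_eq_one := by
        unfold Deconvolution.midpointFun
        rw [integral_div, integral_add (hf.isBoundedOn hlu).integrable
          (hg.isBoundedOn hlu).integrable, hf.isDensityOn.integral_eq_one,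
          hg.isDensityOn.integral_eq_one]
        norm_num }
  absCont := by
    rw [hf.deriv_midpointFun hg]
    have : Deconvolution.midpointFun (deriv f) (deriv g)
        = fun x => (1 / 2 : ℝ) * (deriv f + deriv g) x := by
      ext x; simp [Deconvolution.midpointFun]; ring
    rw [this]
    exact (hf.absCont.add hg.absCont).const_mul _
  memLp := by
    refine MemLp.ae_eq (hf.deriv_deriv_midpointFun hlu hg).symm ?_
    have := (hf.memLp.add hg.memLp).const_mul (1 / 2 : ℝ)
    refine this.ae_eq (ae_of_all _ fun x => ?_)
    simp [Deconvolution.midpointFun]; ring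

/-- The parallelogram law for the penalty. -/
lemma IsCandidate.psi_midpointFun (hlu : l < u) (hf : IsCandidate l u f)
    (hg : IsCandidate l u g) : psi (Deconvolution.midpointFun f g)
      = (psi f + psi g) / 2 - (∫ x, (deriv (deriv f) x - deriv (deriv g) x) ^ 2) / 4 := by
  have h1 : psi (Deconvolution.midpointFun f g)
      = ∫ x, ((deriv (deriv f) x + deriv (deriv g) x) / 2) ^ 2 :=
    integral_congr_ae ((hf.deriv_deriv_midpointFun hlu hg).mono fun x hx => by
      simp only [hx]; rfl)
  have h2 : ∀ x, ((deriv (deriv f) x + deriv (deriv g) x) / 2) ^ 2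
      = (deriv (deriv f) x ^ 2 + deriv (deriv g) x ^ 2) / 2
        - (deriv (deriv f) x - deriv (deriv g) x) ^ 2 / 4 := fun x => by ring
  have i1 := hf.memLp.integrable_sq
  have i2 := hg.memLp.integrable_sq
  have i3 : Integrable fun x => (deriv (deriv f) x - deriv (deriv g) x) ^ 2 :=
    (hf.memLp.sub hg.memLp).integrable_sq
  have i4 : Integrable fun x => (deriv (deriv f) x ^ 2 + deriv (deriv g) x ^ 2) / 2 :=
    (i1.add i2).div_const 2
  rw [h1]
  simp_rw [h2]
  rw [integral_sub i4 (i3.div_const 4), integral_div, integral_div, integral_add i1 i2]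
  rfl

end Candidate

/-! ### Existence of a penalised maximum likelihood estimate -/

section Existence

variable {l u : ℝ}

lemma intervalIntegral_eq_zero_of_notMem_Ioo {q : ℝ → ℝ}
    (hq : ∀ x, x ∉ Set.Icc l u → q x = 0) (hi : ∀ a b, IntervalIntegrable q volume a b)
    (h0 : ∫ t in l..u, q t = 0) {x : ℝ} (hx : x ∉ Set.Ioo l u) : ∫ t in l..x, q t = 0 := by
  rcases le_or_gt x l with h | h
  · refine intervalIntegral.integral_zero_ae ?_
    have h1 : ∀ᵐ t : ℝ, t ≠ l := by simp [ae_iff, measure_singleton]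
    filter_upwards [h1] with t ht hm
    rw [Set.uIoc_of_ge h] at hm
    exact hq t fun h' => ht (le_antisymm hm.2 h'.1)
  · have hux : u ≤ x := not_lt.1 fun h' => hx ⟨h, h'⟩
    rw [← intervalIntegral.integral_add_adjacent_intervals (hi l u) (hi u x), h0, zero_add]
    refine intervalIntegral.integral_zero_ae (ae_of_all _ fun t hm => ?_)
    rw [Set.uIoc_of_le hux] at hm
    exact hq t fun h' => h'.2.not_gt hm.1

/-- Candidates whose second derivatives converge in `L²` converge uniformly to a candidate, namely
to the twofold primitive of the limit. -/
lemma exists_candidate_of_tendsto (hlu : l < u) {f : ℕ → ℝ → ℝ} (hf : ∀ j, IsCandidate l u (f j))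
    {q : ℝ → ℝ} (hq : MemLp q 2) (hq0 : ∀ x, x ∉ Set.Icc l u → q x = 0)
    (hlim : Tendsto (fun j => ∫ x, (deriv (deriv (f j)) x - q x) ^ 2) atTop (𝓝 0)) :
    ∃ F, IsCandidate l u F ∧ psi F = ∫ x, q x ^ 2 ∧
      ∃ c : ℕ → ℝ, Tendsto c atTop (𝓝 0) ∧ ∀ j x, |f j x - F x| ≤ c j := by
  set ε : ℕ → ℝ := fun j => ∫ x, (deriv (deriv (f j)) x - q x) ^ 2
  have hlen : 0 < u - l := sub_pos.2 hlu
  have hqi := intervalIntegrable_of_memLp_two hq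
  set G : ℝ → ℝ := fun x => ∫ t in l..x, q t with hG
  have hGc : Continuous G := intervalIntegral.continuous_primitive hqi l
  have hGi : ∀ a b, IntervalIntegrable G volume a b := hGc.intervalIntegrable
  set F : ℝ → ℝ := fun x => ∫ t in l..x, G t with hF
  have hFd : ∀ x, HasDerivAt F (G x) x := fun x =>
    intervalIntegral.integral_hasDerivAt_right (hGi l x) (hGc.stronglyMeasurableAtFilter _ _)
      hGc.continuousAt
  have hFG : deriv F = G := funext fun x => (hFd x).deriv
  -- uniform convergence of the first derivatives
  have hd1 : ∀ j, ∀ x ∈ Set.Icc l u, |deriv (f j) x - G x| ≤ √((u - l) * ε j) := fun j x hx => by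
    have hm := (hf j).memLp.sub hq
    have h1 := sq_intervalIntegral_le hm hx.1
    simp only [Pi.sub_apply] at h1
    rw [(hf j).deriv_eq_integral hx, hG, ← intervalIntegral.integral_sub
      (intervalIntegrable_of_memLp_two (hf j).memLp l x) (hqi l x)]
    refine Real.abs_le_sqrt (h1.trans ?_)
    have h2 : 0 ≤ ε j := integral_nonneg fun _ => sq_nonneg _
    have h3 := hx.2
    change (x - l) * ε j ≤ _
    gcongr
  -- uniform convergence of the functions
  have hd0 : ∀ j, ∀ x ∈ Set.Icc l u, |f j x - F x| ≤ √((u - l) * ε j) * (u - l) := fun j x hx => by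
    have hcd := (hf j).continuous_deriv hlu
    have h1 : f j x = ∫ t in l..x, deriv (f j) t := by
      rw [intervalIntegral.integral_deriv_eq_sub
        (fun t _ => (hf j).isDensityOn.differentiable t) (hcd.intervalIntegrable _ _),
        (hf j).isDensityOn.left, sub_zero]
    rw [h1, hF, ← intervalIntegral.integral_sub (hcd.intervalIntegrable _ _) (hGi l x)]
    have h2 := intervalIntegral.norm_integral_le_of_norm_le_const
      (f := fun t => deriv (f j) t - G t) (a := l) (b := x) (C := √((u - l) * ε j))
      (fun t ht => by
        rw [Set.uIoc_of_le hx.1] at ht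
        exact hd1 j t ⟨ht.1.le, ht.2.trans hx.2⟩)
    rw [abs_of_nonneg (sub_nonneg.2 hx.1)] at h2
    refine h2.trans ?_
    have := hx.2
    gcongr
  have hc1 : Tendsto (fun j => √((u - l) * ε j)) atTop (𝓝 0) := by
    simpa using (hlim.const_mul (u - l)).sqrt
  have hc : Tendsto (fun j => √((u - l) * ε j) * (u - l)) atTop (𝓝 0) := by
    simpa using hc1.mul_const (u - l)
  have hlimF : ∀ x ∈ Set.Icc l u, Tendsto (fun j => f j x) atTop (𝓝 (F x)) := fun x hx =>
    tendsto_iff_norm_sub_tendsto_zero.2 (squeeze_zero (fun _ => norm_nonneg _)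
      (fun j => hd0 j x hx) hc)
  have hlimG : ∀ x ∈ Set.Icc l u, Tendsto (fun j => deriv (f j) x) atTop (𝓝 (G x)) := fun x hx =>
    tendsto_iff_norm_sub_tendsto_zero.2 (squeeze_zero (fun _ => norm_nonneg _)
      (fun j => hd1 j x hx) hc1)
  have hu : u ∈ Set.Icc l u := ⟨hlu.le, le_rfl⟩
  have hGu : G u = 0 := tendsto_nhds_unique (hlimG u hu) (by
    simp [fun j => (hf j).isDensityOn.deriv_right])
  have hFu : F u = 0 := tendsto_nhds_unique (hlimF u hu) (by
    simp [fun j => (hf j).isDensityOn.right])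
  have hG0 : ∀ x ∉ Set.Ioo l u, G x = 0 := fun x hx =>
    intervalIntegral_eq_zero_of_notMem_Ioo hq0 hqi hGu hx
  have hF0 : ∀ x ∉ Set.Ioo l u, F x = 0 := fun x hx =>
    intervalIntegral_eq_zero_of_notMem_Ioo
      (fun x hx => hG0 x fun h => hx (Set.Ioo_subset_Icc_self h)) hGi hFu hx
  have hd : ∀ j x, |f j x - F x| ≤ √((u - l) * ε j) * (u - l) := fun j x => by
    by_cases hx : x ∈ Set.Icc l u
    · exact hd0 j x hx
    · rw [(hf j).isDensityOn.eq_zero x hx, hF0 x fun h => hx (Set.Ioo_subset_Icc_self h)]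
      simp only [sub_self, abs_zero]
      positivity
  have hFint : ∫ x, F x = 1 := by
    have hFc : Continuous F := continuous_iff_continuousAt.2 fun x => (hFd x).continuousAt
    have hr : ∀ {w : ℝ → ℝ}, (∀ x ∉ Set.Icc l u, w x = 0) → ∫ x, w x = ∫ x in l..u, w x :=
      fun {w} hw => by
        rw [intervalIntegral.integral_of_le hlu.le, ← integral_Icc_eq_integral_Ioc,
          setIntegral_eq_integral_of_forall_compl_eq_zero hw]
    have hFr := hr (w := F) fun x hx => hF0 x fun h => hx (Set.Ioo_subset_Icc_self h)
    have h1 : ∀ j, |1 - ∫ x, F x| ≤ √((u - l) * ε j) * (u - l) * |u - l| := fun j => by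
      rw [← (hf j).isDensityOn.integral_eq_one, hr (hf j).isDensityOn.eq_zero, hFr,
        ← intervalIntegral.integral_sub
          ((hf j).isDensityOn.differentiable.continuous.intervalIntegrable _ _)
          (hFc.intervalIntegrable _ _)]
      exact intervalIntegral.norm_integral_le_of_norm_le_const (f := fun t => f j t - F t)
        fun t _ => hd j t
    have h2 : |1 - ∫ x, F x| ≤ 0 :=
      ge_of_tendsto' (by simpa using hc.mul_const |u - l|) h1
    have := abs_nonpos_iff.1 h2
    linarith
  have hae : deriv G =ᵐ[volume] q := by
    have hql : LocallyIntegrable q := hq.locallyIntegrable (by norm_num)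
    filter_upwards [LocallyIntegrable.ae_hasDerivAt_integral hql] with x hx
    exact (hx l).deriv
  refine ⟨F, ⟨⟨fun x => (hFd x).differentiableAt, hF0 l (by simp), ?_, hF0 u (by simp), ?_,
    fun x => ?_, fun x hx => hF0 x fun h => hx (Set.Ioo_subset_Icc_self h), hFint⟩, ?_, ?_⟩, ?_,
    _, hc, hd⟩
  · rw [hFG]; exact hG0 l (by simp)
  · rw [hFG]; exact hG0 u (by simp)
  · by_cases hx : x ∈ Set.Icc l u
    · exact ge_of_tendsto' (hlimF x hx) fun j => (hf j).isDensityOn.nonneg x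
    · exact (hF0 x fun h => hx (Set.Ioo_subset_Icc_self h)).ge
  · rw [hFG]
    exact (hqi l u).absolutelyContinuousOnInterval_intervalIntegral (by simp)
  · rw [hFG]; exact hq.ae_eq hae.symm
  · rw [psi, hFG]
    exact integral_congr_ae (hae.mono fun x hx => by simp only [hx])

variable {μ : Measure ℝ} [IsProbabilityMeasure μ] {lam : ℝ} {n : ℕ} {y : ℕ → ℝ} {f g : ℝ → ℝ}

lemma conv_midpointFun (hlu : l < u) (hf : IsCandidate l u f) (hg : IsCandidate l u g) (y : ℝ) :
    conv (midpointFun f g) μ y = (conv f μ y + conv g μ y) / 2 := by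
  simp only [conv, midpointFun]
  rw [integral_div, integral_add ((hf.isBoundedOn hlu).integrable_comp_sub y)
    ((hg.isBoundedOn hlu).integrable_comp_sub y)]

lemma PosLikelihood.midpointFun (hlu : l < u) (hf : IsCandidate l u f) (hg : IsCandidate l u g)
    (pf : PosLikelihood μ n y f) (pg : PosLikelihood μ n y g) :
    PosLikelihood μ n y (midpointFun f g) := fun i hi => by
  rw [conv_midpointFun hlu hf hg]
  have := pf i hi
  have := pg i hi
  positivity

/-- The penalised likelihood is convex, and uniformly so in the second derivative. -/
lemma objective_midpointFun_le (hlu : l < u) (hf : IsCandidate l u f) (hg : IsCandidate l u g)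
    (pf : PosLikelihood μ n y f) (pg : PosLikelihood μ n y g) :
    objective μ lam n y (midpointFun f g) ≤ (objective μ lam n y f + objective μ lam n y g) / 2
      - lam * (∫ x, (deriv (deriv f) x - deriv (deriv g) x) ^ 2) / 4 := by
  have hlog : (∑ i ∈ Finset.range n, Real.log (conv f μ (y i))
      + ∑ i ∈ Finset.range n, Real.log (conv g μ (y i))) / 2
      ≤ ∑ i ∈ Finset.range n, Real.log (conv (midpointFun f g) μ (y i)) := by
    rw [← Finset.sum_add_distrib, Finset.sum_div]
    refine Finset.sum_le_sum fun i hi => ?_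
    have h1 := pf i (Finset.mem_range.1 hi)
    have h2 := pg i (Finset.mem_range.1 hi)
    have h3 : Real.log ((conv f μ (y i) + conv g μ (y i)) / 2) * 2
        = Real.log (((conv f μ (y i) + conv g μ (y i)) / 2) ^ 2) := by
      rw [Real.log_pow]; push_cast; ring
    rw [conv_midpointFun hlu hf hg, ← Real.log_mul h1.ne' h2.ne', div_le_iff₀ two_pos, h3]
    refine Real.log_le_log (by positivity) ?_
    nlinarith [sq_nonneg (conv f μ (y i) - conv g μ (y i))]
  unfold objective
  rw [hf.psi_midpointFun hlu hg]
  linarith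

lemma log_conv_le (hlu : l < u) (hf : IsCandidate l u f) {z : ℝ} (hz : 0 < conv f μ z) :
    Real.log (conv f μ z) ≤ √(psi f * (u - l)) * (u - l) := by
  have h1 := Real.log_le_sub_one_of_pos hz
  have h2 := conv_le (μ := μ) (hf.isBoundedOn hlu) z
  linarith

lemma sum_log_conv_le (hlu : l < u) (hf : IsCandidate l u f) (pf : PosLikelihood μ n y f) :
    ∑ i ∈ Finset.range n, Real.log (conv f μ (y i)) ≤ n * (√(psi f * (u - l)) * (u - l)) := by
  have := Finset.sum_le_card_nsmul (Finset.range n) (fun i => Real.log (conv f μ (y i))) _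
    fun i hi => log_conv_le hlu hf (pf i (Finset.mem_range.1 hi))
  simpa using this

lemma exists_le_objective (hlu : l < u) (hlam : 0 < lam) :
    ∃ c, ∀ f, IsCandidate l u f → PosLikelihood μ n y f → c ≤ objective μ lam n y f := by
  refine ⟨-(n * √(u - l) * (u - l)) ^ 2 / (4 * lam), fun f hf pf => ?_⟩
  have h1 := sum_log_conv_le hlu hf pf
  have h0 := psi_nonneg f
  rw [Real.sqrt_mul h0] at h1
  have h2 := Real.sq_sqrt h0
  unfold objective
  rw [div_le_iff₀ (by positivity)]
  have h3 := mul_le_mul_of_nonneg_right h1 (by positivity : 0 ≤ 4 * lam)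
  have h4 : lam ^ 2 * √(psi f) ^ 2 = lam ^ 2 * psi f := by rw [h2]
  nlinarith [sq_nonneg (2 * lam * √(psi f) - n * √(u - l) * (u - l))]

/-- As soon as one candidate has positive likelihood, a penalised maximum likelihood estimate
exists. By uniform convexity, the second derivatives along a minimising sequence are a Cauchy
sequence in `L²`. -/
theorem exists_isPMLE (hlu : l < u) (hlam : 0 < lam) {f₀ : ℝ → ℝ} (hf₀ : IsCandidate l u f₀)
    (pf₀ : PosLikelihood μ n y f₀) : ∃ f, IsPMLE l u μ lam n y f := by
  set S : Set ℝ := {t | ∃ f, IsCandidate l u f ∧ PosLikelihood μ n y f ∧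
    objective μ lam n y f = t}
  have hSne : S.Nonempty := ⟨_, f₀, hf₀, pf₀, rfl⟩
  have hSbdd : BddBelow S := by
    obtain ⟨c, hc⟩ := exists_le_objective (n := n) (y := y) (μ := μ) hlu hlam
    exact ⟨c, by rintro _ ⟨f, hf, pf, rfl⟩; exact hc f hf pf⟩
  set I := sInf S
  have hI : ∀ f, IsCandidate l u f → PosLikelihood μ n y f → I ≤ objective μ lam n y f :=
    fun f hf pf => csInf_le hSbdd ⟨f, hf, pf, rfl⟩
  have hseq : ∀ j : ℕ, ∃ f, IsCandidate l u f ∧ PosLikelihood μ n y f ∧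
      objective μ lam n y f < I + 1 / ((j : ℝ) + 1) := fun j => by
    obtain ⟨_, ⟨f, hf, pf, rfl⟩, h⟩ := exists_lt_of_csInf_lt hSne
      (lt_add_of_pos_right I (by positivity : 0 < 1 / ((j : ℝ) + 1)))
    exact ⟨f, hf, pf, h⟩
  choose f hf pf hobj using hseq
  have hcauchy : ∀ j k, ∫ x, (deriv (deriv (f j)) x - deriv (deriv (f k)) x) ^ 2
      ≤ 2 / lam * (1 / ((j : ℝ) + 1) + 1 / ((k : ℝ) + 1)) := fun j k => by
    have h1 := objective_midpointFun_le (lam := lam) hlu (hf j) (hf k) (pf j) (pf k)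
    have h2 := hI _ ((hf j).midpointFun hlu (hf k)) ((pf j).midpointFun hlu (hf j) (hf k) (pf k))
    have h3 := hobj j
    have h4 := hobj k
    rw [div_mul_eq_mul_div, le_div_iff₀ hlam]
    linarith
  -- the limit of the second derivatives
  set D : ℕ → Lp ℝ 2 (volume : Measure ℝ) := fun j => (hf j).memLp.toLp
  have hnorm : ∀ (v : Lp ℝ 2 (volume : Measure ℝ)), ‖v‖ ^ 2 = ∫ x, v x ^ 2 := fun v => by
    rw [← real_inner_self_eq_norm_sq, L2.inner_def]
    simp [sq]
  have hDD : ∀ j k, ‖D j - D k‖ ^ 2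
      = ∫ x, (deriv (deriv (f j)) x - deriv (deriv (f k)) x) ^ 2 := fun j k => by
    rw [hnorm]
    refine integral_congr_ae ?_
    filter_upwards [Lp.coeFn_sub (D j) (D k), (hf j).memLp.coeFn_toLp,
      (hf k).memLp.coeFn_toLp] with x h1 h2 h3
    simp only [h1, Pi.sub_apply, D, h2, h3]
  have hDc : CauchySeq D := by
    refine Metric.cauchySeq_iff'.2 fun ε hε => ?_
    obtain ⟨N, hN⟩ := exists_nat_one_div_lt (show 0 < lam * ε ^ 2 / 4 by positivity)
    refine ⟨N, fun j hj => ?_⟩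
    rw [dist_eq_norm]
    refine lt_of_pow_lt_pow_left₀ 2 hε.le ?_
    rw [hDD]
    refine (hcauchy j N).trans_lt ?_
    have hj' : 1 / ((j : ℝ) + 1) ≤ 1 / ((N : ℝ) + 1) := by
      have : (N : ℝ) ≤ j := by exact_mod_cast hj
      gcongr
    rw [div_mul_eq_mul_div, div_lt_iff₀ hlam]
    linarith
  obtain ⟨Q, hQ⟩ := cauchySeq_tendsto_of_complete hDc
  set q : ℝ → ℝ := Set.indicator (Set.Icc l u) Q
  have hq : MemLp q 2 := (Lp.memLp Q).indicator measurableSet_Icc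
  have hDQ : ∀ j, ‖D j - Q‖ ^ 2 = ∫ x, (deriv (deriv (f j)) x - Q x) ^ 2 := fun j => by
    rw [hnorm]
    refine integral_congr_ae ?_
    filter_upwards [Lp.coeFn_sub (D j) Q, (hf j).memLp.coeFn_toLp] with x h1 h2
    simp only [h1, Pi.sub_apply, D, h2]
  have hlim : Tendsto (fun j => ∫ x, (deriv (deriv (f j)) x - q x) ^ 2) atTop (𝓝 0) := by
    have h1 : Tendsto (fun j => ‖D j - Q‖ ^ 2) atTop (𝓝 0) := by
      simpa using (tendsto_iff_norm_sub_tendsto_zero.1 hQ).pow 2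
    refine squeeze_zero (fun j => integral_nonneg fun _ => sq_nonneg _) (fun j => ?_) h1
    rw [hDQ]
    refine integral_mono ((hf j).memLp.sub hq).integrable_sq
      ((hf j).memLp.sub (Lp.memLp Q)).integrable_sq fun x => ?_
    by_cases hx : x ∈ Set.Icc l u
    · simp [q, Set.indicator_of_mem hx]
    · simp [q, Set.indicator_of_notMem hx, (hf j).isDensityOn.deriv_deriv_eq_zero hx, sq_nonneg]
  obtain ⟨F, hF, hFpsi, c, hc, hcF⟩ := exists_candidate_of_tendsto hlu hf hq
    (fun x hx => Set.indicator_of_notMem hx _) hlim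
  have hpsi : Tendsto (fun j => psi (f j)) atTop (𝓝 (∫ x, Q x ^ 2)) := by
    have h1 : ∀ j, psi (f j) = ‖D j‖ ^ 2 := fun j => by
      rw [hnorm]
      exact integral_congr_ae ((hf j).memLp.coeFn_toLp.mono fun x hx => by simp only [D, hx])
    simp_rw [h1, ← hnorm]
    exact hQ.norm.pow 2
  have hpsiF : psi F ≤ ∫ x, Q x ^ 2 := by
    rw [hFpsi]
    refine integral_mono hq.integrable_sq (Lp.memLp Q).integrable_sq fun x => ?_
    by_cases hx : x ∈ Set.Icc l u
    · simp [q, Set.indicator_of_mem hx]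
    · simp [q, Set.indicator_of_notMem hx, sq_nonneg]
  have hconv : ∀ z, Tendsto (fun j => conv (f j) μ z) atTop (𝓝 (conv F μ z)) := fun z => by
    refine tendsto_iff_norm_sub_tendsto_zero.2 (squeeze_zero (fun _ => norm_nonneg _)
      (fun j => ?_) hc)
    rw [Real.norm_eq_abs, abs_sub_le_iff]
    have h1 := conv_le_conv_add (μ := μ) ((hf j).isBoundedOn hlu) (hF.isBoundedOn hlu) (c := c j)
      (fun x => by linarith [(abs_sub_le_iff.1 (hcF j x)).1]) z
    have h2 := conv_le_conv_add (μ := μ) (hF.isBoundedOn hlu) ((hf j).isBoundedOn hlu) (c := c j)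
      (fun x => by linarith [(abs_sub_le_iff.1 (hcF j x)).2]) z
    exact ⟨by linarith, by linarith⟩
  -- the likelihood of the limit is positive, as all factors stay bounded
  have hpos : PosLikelihood μ n y F := fun i hi => by
    obtain ⟨C, hC⟩ := hpsi.bddAbove_range
    have hC' : ∀ j, psi (f j) ≤ C := fun j => hC ⟨j, rfl⟩
    set A := √(C * (u - l)) * (u - l)
    have hlen : 0 < u - l := sub_pos.2 hlu
    have hA0 : 0 ≤ A := by positivity
    have hA : ∀ j, √(psi (f j) * (u - l)) * (u - l) ≤ A := fun j => by
      have := hC' j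
      change _ ≤ √(C * (u - l)) * (u - l)
      gcongr
    have hlow : ∀ j, Real.exp (-(I + 1 + n * A)) ≤ conv (f j) μ (y i) := fun j => by
      have hp := pf j i hi
      rw [← Real.le_log_iff_exp_le hp]
      have h1 := (hobj j).le
      have h2 : (1 : ℝ) / ((j : ℝ) + 1) ≤ 1 := by
        rw [div_le_one (by positivity)]; linarith [(j.cast_nonneg : (0 : ℝ) ≤ j)]
      have h3 : ∑ k ∈ (Finset.range n).erase i, Real.log (conv (f j) μ (y k)) ≤ n * A := by
        have h4 := Finset.sum_le_card_nsmul ((Finset.range n).erase i)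
          (fun k => Real.log (conv (f j) μ (y k))) A fun k hk =>
            (log_conv_le hlu (hf j) (pf j k
              (Finset.mem_range.1 (Finset.mem_of_mem_erase hk)))).trans (hA j)
        refine h4.trans ?_
        rw [nsmul_eq_mul]
        have : ((Finset.range n).erase i).card ≤ n := by
          simpa using Finset.card_erase_le (s := Finset.range n) (a := i)
        gcongr
      have h5 := Finset.add_sum_erase (Finset.range n)
        (fun k => Real.log (conv (f j) μ (y k))) (Finset.mem_range.2 hi)
      have h6 : 0 ≤ lam * psi (f j) := mul_nonneg hlam.le (psi_nonneg _)
      unfold objective at h1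
      linarith
    exact (Real.exp_pos _).trans_le (ge_of_tendsto' (hconv (y i)) hlow)
  refine ⟨F, hF, hpos, fun g hg pg => le_trans ?_ (hI g hg pg)⟩
  have hlimobj : Tendsto (fun j => objective μ lam n y (f j)) atTop
      (𝓝 (-(∑ i ∈ Finset.range n, Real.log (conv F μ (y i))) + lam * ∫ x, Q x ^ 2)) := by
    refine Tendsto.add (tendsto_finsetSum _ fun i hi => ?_).neg (hpsi.const_mul lam)
    exact (hconv (y i)).log (hpos i (Finset.mem_range.1 hi)).ne'
  have hle : -(∑ i ∈ Finset.range n, Real.log (conv F μ (y i))) + lam * ∫ x, Q x ^ 2 ≤ I := by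
    have h1 : Tendsto (fun j : ℕ => I + 1 / ((j : ℝ) + 1)) atTop (𝓝 (I + 0)) :=
      tendsto_const_nhds.add tendsto_one_div_add_atTop_nhds_zero_nat
    simpa using le_of_tendsto_of_tendsto' hlimobj h1 fun j => (hobj j).le
  refine le_trans ?_ hle
  unfold objective
  gcongr

end Existence

/-! ### A uniform exponential inequality for log-likelihood ratios -/

section Sampling

variable {Ω : Type*} [MeasurableSpace Ω] {P : Measure Ω}

/-- The law of the sum of a variable with density `w` and an independent variable with law `μ`. -/
lemma map_add_eq_withDensity_conv [IsProbabilityMeasure P] {l u A : ℝ} {w : ℝ → ℝ}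
    (hw : IsBoundedOn l u A w) {μ : Measure ℝ} [IsProbabilityMeasure μ] {X ε : Ω → ℝ}
    (hX : Measurable X) (hε : Measurable ε) (hind : IndepFun X ε P)
    (lX : P.map X = volume.withDensity fun x => ENNReal.ofReal (w x)) (lε : P.map ε = μ) :
    P.map (fun ω => X ω + ε ω) = volume.withDensity fun y => ENNReal.ofReal (conv w μ y) := by
  ext s hs
  have hq : Measurable (s.indicator (1 : ℝ → ℝ≥0∞)) := measurable_one.indicator hs
  have hq2 : Measurable fun p : ℝ × ℝ => s.indicator (1 : ℝ → ℝ≥0∞) (p.1 + p.2) :=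
    hq.comp (measurable_fst.add measurable_snd)
  have hprod := (indepFun_iff_map_prod_eq_prod_map_map hX.aemeasurable hε.aemeasurable).1 hind
  have : SFinite (P.map X) := inferInstance
  calc P.map (fun ω => X ω + ε ω) s
      = ∫⁻ y, s.indicator 1 y ∂(P.map fun ω => X ω + ε ω) := (lintegral_indicator_one hs).symm
    _ = ∫⁻ ω, s.indicator 1 (X ω + ε ω) ∂P := lintegral_map hq (hX.add hε)
    _ = ∫⁻ p, s.indicator 1 (p.1 + p.2) ∂(P.map fun ω => (X ω, ε ω)) :=
        (lintegral_map hq2 (hX.prodMk hε)).symm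
    _ = ∫⁻ e, ∫⁻ x, s.indicator 1 (x + e) ∂(P.map X) ∂(P.map ε) := by
        rw [hprod, lintegral_prod_symm _ hq2.aemeasurable]
    _ = ∫⁻ e, ∫⁻ x, ENNReal.ofReal (w x) * s.indicator 1 (x + e) ∂volume ∂μ := by
        rw [lX, lε]
        refine lintegral_congr fun e => ?_
        exact lintegral_withDensity_eq_lintegral_mul _ hw.measurable.ennreal_ofReal
          (hq.comp (measurable_id.add_const e))
    _ = ∫⁻ y, ENNReal.ofReal (conv w μ y) * s.indicator 1 y := (lintegral_mul_conv hw hq).symm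
    _ = volume.withDensity (fun y => ENNReal.ofReal (conv w μ y)) s := by
        rw [withDensity_apply _ hs, ← lintegral_indicator hs]
        refine lintegral_congr fun y => ?_
        by_cases hy : y ∈ s <;> simp [hy]

/-- A sample point has almost surely positive density. -/
lemma ae_density_pos {g : ℝ → ℝ} (hg : Measurable g) {Z : Ω → ℝ} (hZ : Measurable Z)
    (law : P.map Z = volume.withDensity fun y => ENNReal.ofReal (g y)) :
    ∀ᵐ ω ∂P, 0 < g (Z ω) := by
  have h : ∀ᵐ y ∂(P.map Z), 0 < g y := by
    rw [law, ae_withDensity_iff hg.ennreal_ofReal]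
    exact ae_of_all _ fun y hy => by simpa using hy
  exact ae_of_ae_map hZ.aemeasurable h

/-- Chernoff's bound for a product of independent factors. -/
lemma measure_le_prod_le {Z : ℕ → Ω → ℝ} (hZ : ∀ j, Measurable (Z j)) (hind : iIndepFun Z P)
    {q : ℝ → ℝ≥0∞} (hq : Measurable q) {θ : ℝ}
    (hθ : ∀ j, ∫⁻ ω, q (Z j ω) ∂P ≤ ENNReal.ofReal (Real.exp θ)) (n : ℕ) (s : ℝ) :
    P {ω | ENNReal.ofReal (Real.exp (n * θ + s)) ≤ ∏ i ∈ Finset.range n, q (Z i ω)}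
      ≤ ENNReal.ofReal (Real.exp (-s)) := by
  have hprod : ∫⁻ ω, ∏ i ∈ Finset.range n, q (Z i ω) ∂P ≤ ENNReal.ofReal (Real.exp (n * θ)) := by
    rw [lintegral_prod_eq_prod_lintegral_of_indepFun (Finset.range n) (fun i ω => q (Z i ω))
      (hind.comp (fun _ => q) fun _ => hq) fun i => hq.comp (hZ i)]
    refine (Finset.prod_le_prod' fun i _ => hθ i).trans_eq ?_
    rw [Finset.prod_const, Finset.card_range, ← ENNReal.ofReal_pow (Real.exp_pos _).le,
      ← Real.exp_nat_mul]
  have hmarkov := mul_meas_ge_le_lintegral (μ := P)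
    (Finset.measurable_prod (Finset.range n) fun i _ => hq.comp (hZ i))
    (ENNReal.ofReal (Real.exp (n * θ + s)))
  have h1 := hmarkov.trans hprod
  have h0 : ENNReal.ofReal (Real.exp (n * θ + s)) ≠ 0 := by simp [Real.exp_pos]
  rw [mul_comm, ← ENNReal.le_div_iff_mul_le (Or.inl h0) (Or.inl ENNReal.ofReal_ne_top),
    ← ENNReal.ofReal_div_of_pos (Real.exp_pos _), ← Real.exp_sub] at h1
  rw [sub_add_cancel_left] at h1
  exact h1

/-- A union bound over finite classes whose cardinality may grow with the sample size, together
with the Borel-Cantelli lemma. -/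
lemma ae_eventually_prod_lt {Z : ℕ → Ω → ℝ} (hZ : ∀ j, Measurable (Z j)) (hind : iIndepFun Z P)
    {K : ℕ → Type*} [∀ n, Fintype (K n)] {q : ∀ n, K n → ℝ → ℝ≥0∞}
    (hq : ∀ n k, Measurable (q n k)) {θ : ∀ n, K n → ℝ}
    (hθ : ∀ n k j, ∫⁻ ω, q n k (Z j ω) ∂P ≤ ENNReal.ofReal (Real.exp (θ n k)))
    {N : ℕ → ℝ} (hN : ∀ n, (Fintype.card (K n) : ℝ) ≤ Real.exp (N n)) :
    ∀ᵐ ω ∂P, ∀ᶠ n in atTop, ∀ k, ∏ i ∈ Finset.range n, q n k (Z i ω)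
      < ENNReal.ofReal (Real.exp (n * θ n k + (N n + 2 * Real.log (n + 1)))) := by
  set bad : ℕ → Set Ω := fun n => ⋃ k : K n,
    {ω | ENNReal.ofReal (Real.exp (n * θ n k + (N n + 2 * Real.log (n + 1))))
      ≤ ∏ i ∈ Finset.range n, q n k (Z i ω)}
  have hbad : ∀ n, P (bad n) ≤ ENNReal.ofReal (1 / ((n : ℝ) + 1) ^ 2) := fun n => by
    refine (measure_iUnion_fintype_le _ _).trans ?_
    refine (Finset.sum_le_sum fun k _ => measure_le_prod_le hZ hind (hq n k) (hθ n k) n _).trans ?_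
    rw [Finset.sum_const, nsmul_eq_mul, ← ENNReal.ofReal_natCast,
      ← ENNReal.ofReal_mul (Nat.cast_nonneg _)]
    refine ENNReal.ofReal_le_ofReal ?_
    have hn : (0 : ℝ) < n + 1 := by positivity
    have h1 : Real.exp (-(N n + 2 * Real.log (n + 1)))
        = Real.exp (-(N n)) * (1 / ((n : ℝ) + 1) ^ 2) := by
      rw [neg_add, Real.exp_add, Real.exp_neg (2 * _), two_mul, Real.exp_add, Real.exp_log hn]
      field_simp
    rw [h1, ← mul_assoc]
    refine mul_le_of_le_one_left (by positivity) ?_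
    rw [Real.exp_neg, ← div_eq_mul_inv]
    exact div_le_one_of_le₀ (hN n) (Real.exp_pos _).le
  have hsum : ∑' n, P (bad n) ≠ ∞ := by
    refine ne_top_of_le_ne_top ?_ (ENNReal.tsum_le_tsum hbad)
    have hs : Summable fun n : ℕ => 1 / ((n : ℝ) + 1) ^ 2 := by
      have := (summable_nat_add_iff 1).2 (Real.summable_one_div_nat_pow.2 (one_lt_two))
      simpa using this
    exact hs.tsum_ofReal_ne_top
  filter_upwards [ae_eventually_notMem hsum] with ω hω
  filter_upwards [hω] with n hn k
  by_contra h
  exact hn (Set.mem_iUnion.2 ⟨k, not_lt.1 h⟩)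

/-- If `g` is the density of the observations and `H` runs through finite classes of cardinality
at most `exp (N n)`, then eventually all log-likelihood ratios of `H` against `g` are negative with
a drift given by the discrimination, up to the excess mass of `H` and the size of the class. The
moment generating function at `1 / 2` gives this without any moment assumption on the logarithms. -/
theorem ae_eventually_sum_log_lt {Z : ℕ → Ω → ℝ} (hZ : ∀ j, Measurable (Z j))
    (hind : iIndepFun Z P) {g : ℝ → ℝ} (mg : Measurable g) (hg : Integrable g)
    (hg0 : ∀ y, 0 ≤ g y) (hg1 : ∫ y, g y = 1)
    (law : ∀ j, P.map (Z j) = volume.withDensity fun y => ENNReal.ofReal (g y))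
    {K : ℕ → Type*} [∀ n, Fintype (K n)] {H : ∀ n, K n → ℝ → ℝ}
    (mH : ∀ n k, Measurable (H n k)) (hH : ∀ n k, Integrable (H n k)) (hH0 : ∀ n k y, 0 ≤ H n k y)
    {N : ℕ → ℝ} (hN : ∀ n, (Fintype.card (K n) : ℝ) ≤ Real.exp (N n)) :
    ∀ᵐ ω ∂P, ∀ᶠ n : ℕ in atTop, ∀ k, (∀ i < n, 0 < H n k (Z i ω)) →
      ∑ i ∈ Finset.range n, (Real.log (H n k (Z i ω)) - Real.log (g (Z i ω)))
        < n * ((∫ y, H n k y) - 1 - discrimination (H n k) g / 2)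
          + 2 * N n + 4 * Real.log (n + 1) := by
  have hq : ∀ n k, Measurable fun y => ENNReal.ofReal √(H n k y / g y) := fun n k =>
    ((mH n k).div mg).sqrt.ennreal_ofReal
  have hθ : ∀ n k j, ∫⁻ ω, ENNReal.ofReal √(H n k (Z j ω) / g (Z j ω)) ∂P
      ≤ ENNReal.ofReal (Real.exp (((∫ y, H n k y) - 1) / 2 - discrimination (H n k) g / 4)) :=
    fun n k j => by
      rw [← lintegral_map (hq n k) (hZ j), law j,
        lintegral_withDensity_eq_lintegral_mul _ mg.ennreal_ofReal (hq n k)]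
      refine (lintegral_mul_sqrt_div_le (hH n k) hg (mH n k) mg (hH0 n k) hg0).trans ?_
      refine ENNReal.ofReal_le_ofReal ?_
      have := Real.add_one_le_exp (((∫ y, H n k y) - 1) / 2 - discrimination (H n k) g / 4)
      rw [hg1]
      linarith
  filter_upwards [ae_eventually_prod_lt hZ hind hq hθ hN,
    ae_all_iff.2 fun j => ae_density_pos mg (hZ j) (law j)] with ω hω hpos
  filter_upwards [hω] with n hn k hk
  have h1 := hn k
  rw [← ENNReal.ofReal_prod_of_nonneg fun i _ => Real.sqrt_nonneg _,
    ENNReal.ofReal_lt_ofReal_iff (Real.exp_pos _)] at h1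
  have hr : ∀ i ∈ Finset.range n, 0 < √(H n k (Z i ω) / g (Z i ω)) := fun i hi =>
    Real.sqrt_pos.2 (div_pos (hk i (Finset.mem_range.1 hi)) (hpos i))
  rw [← Real.log_lt_iff_lt_exp (Finset.prod_pos hr), Real.log_prod fun i hi => (hr i hi).ne'] at h1
  have h2 : ∑ i ∈ Finset.range n, Real.log √(H n k (Z i ω) / g (Z i ω))
      = (∑ i ∈ Finset.range n, (Real.log (H n k (Z i ω)) - Real.log (g (Z i ω)))) / 2 := by
    rw [Finset.sum_div]
    refine Finset.sum_congr rfl fun i hi => ?_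
    have h3 := hk i (Finset.mem_range.1 hi)
    rw [Real.log_sqrt (div_pos h3 (hpos i)).le, Real.log_div h3.ne' (hpos i).ne']
  rw [h2] at h1
  linarith

end Sampling

/-! ### Upper step functions -/

section Step

variable {l u η : ℝ} {M n : ℕ}

/-- The number of the cell of `x`, when `[l, u]` is cut into `M` cells of equal length. The right
endpoint `u` has a cell of its own. -/
def cell (l u : ℝ) (M : ℕ) (x : ℝ) : Fin (M + 1) :=
  ⟨min ⌊(x - l) / (u - l) * M⌋₊ M, Nat.lt_succ_of_le (min_le_right _ _)⟩

/-- The step function on `[l, u]` with value `η (k j + 2)` on the cell with number `j`. The summand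
`2` makes it an upper bound for the functions which it approximates. -/
def stepFun (l u η : ℝ) (k : Fin (M + 1) → Fin (n + 1)) : ℝ → ℝ :=
  (Set.Icc l u).indicator fun x => η * ((k (cell l u M x) : ℕ) + 2)

lemma isBoundedOn_stepFun (hη : 0 ≤ η) (k : Fin (M + 1) → Fin (n + 1)) :
    IsBoundedOn l u (η * (n + 2)) (stepFun l u η k) where
  measurable := by
    refine Measurable.indicator ?_ measurableSet_Icc
    have h1 : Measurable fun x : ℝ => ⌊(x - l) / (u - l) * M⌋₊ :=
      (((measurable_id.sub_const l).div_const (u - l)).mul_const (M : ℝ)).nat_floor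
    have h2 : Measurable fun j : ℕ =>
        η * ((k ⟨min j M, Nat.lt_succ_of_le (min_le_right _ _)⟩ : ℕ) + 2) := measurable_from_top
    exact h2.comp h1
  nonneg x := Set.indicator_nonneg (fun x _ => by positivity) x
  le x := by
    refine Set.indicator_apply_le' (fun _ => ?_) fun _ => by positivity
    have : ((k (cell l u M x) : ℕ) : ℝ) ≤ n := by
      exact_mod_cast Nat.le_of_lt_succ (k (cell l u M x)).2
    gcongr
  eq_zero x hx := Set.indicator_of_notMem hx _

lemma abs_sub_cell_le (hlu : l < u) (hM : 0 < M) {x : ℝ} (hx : x ∈ Set.Icc l u) :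
    |x - (l + (cell l u M x : ℕ) * ((u - l) / M))| ≤ (u - l) / M := by
  have hlen : 0 < u - l := sub_pos.2 hlu
  have hM' : (0 : ℝ) < M := by exact_mod_cast hM
  set t := (x - l) / (u - l) * M
  have h1 : (x - l) / (u - l) ≤ 1 := (div_le_one hlen).2 (by linarith [hx.2])
  have h0 : 0 ≤ t := mul_nonneg (div_nonneg (by linarith [hx.1]) hlen.le) hM'.le
  have htM : t ≤ M := by
    simpa using mul_le_mul_of_nonneg_right h1 hM'.le
  have hcell : (cell l u M x : ℕ) = ⌊t⌋₊ :=
    min_eq_left (by exact_mod_cast (Nat.floor_le h0).trans htM)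
  have hxt : x = l + t * ((u - l) / M) := by
    simp only [t]; field_simp; ring
  have h2 := Nat.floor_le h0
  have h3 := Nat.lt_floor_add_one t
  have h4 : x - (l + (cell l u M x : ℕ) * ((u - l) / M)) = (t - ⌊t⌋₊) * ((u - l) / M) := by
    rw [hcell]; linear_combination hxt
  rw [h4, abs_of_nonneg (mul_nonneg (by linarith) (by positivity))]
  exact mul_le_of_le_one_left (by positivity) (by linarith)

/-- Lipschitz functions are approximated from above by step functions. -/
lemma exists_stepFun (hlu : l < u) (hη : 0 < η) (hM : 0 < M) {f : ℝ → ℝ} {L : ℝ}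
    (hf : ∀ x y, |f x - f y| ≤ L * |x - y|) (hf0 : ∀ x, 0 ≤ f x) (hfn : ∀ x, f x ≤ η * n)
    (hL : L * (u - l) ≤ η * M) :
    ∃ k : Fin (M + 1) → Fin (n + 1), ∀ x ∈ Set.Icc l u,
      f x ≤ stepFun l u η k x ∧ stepFun l u η k x ≤ f x + 3 * η := by
  set p : Fin (M + 1) → ℝ := fun j => l + (j : ℕ) * ((u - l) / M)
  have hk : ∀ j, ⌊f (p j) / η⌋₊ < n + 1 := fun j => by
    refine Nat.lt_succ_of_le (Nat.floor_le_of_le ?_)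
    rw [div_le_iff₀ hη, mul_comm]
    exact hfn _
  have hL0 : 0 ≤ L := by simpa using (abs_nonneg _).trans (hf 0 1)
  have hM' : (0 : ℝ) < M := by exact_mod_cast hM
  refine ⟨fun j => ⟨_, hk j⟩, fun x hx => ?_⟩
  simp only [stepFun, Set.indicator_of_mem hx]
  set j := cell l u M x
  have h1 : |f x - f (p j)| ≤ η := by
    refine (hf _ _).trans ((mul_le_mul_of_nonneg_left (abs_sub_cell_le hlu hM hx) hL0).trans ?_)
    rw [← mul_div_assoc, div_le_iff₀ hM']
    exact hL
  have h2 := Nat.floor_le (div_nonneg (hf0 (p j)) hη.le)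
  have h3 := Nat.lt_floor_add_one (f (p j) / η)
  rw [le_div_iff₀ hη] at h2
  rw [div_lt_iff₀ hη] at h3
  have h4 := abs_sub_le_iff.1 h1
  constructor <;> nlinarith

lemma card_stepFun_index :
    (Fintype.card (Fin (M + 1) → Fin (n + 1)) : ℝ)
      ≤ Real.exp ((M + 1) * Real.log (n + 1)) := by
  have hn : (0 : ℝ) < n + 1 := by positivity
  simp only [Fintype.card_pi, Fintype.card_fin, Finset.prod_const, Finset.card_univ]
  push_cast
  rw [mul_comm, Real.exp_mul, Real.exp_log hn]
  exact_mod_cast le_rfl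

end Step

/-! ### Deterministic consequences of the minimality of the estimate -/

section Deterministic

variable {l u : ℝ} {μ : Measure ℝ} {lam : ℝ} {n : ℕ} {y : ℕ → ℝ} {f f₀ : ℝ → ℝ}

lemma IsPMLE.penalty_le (h : IsPMLE l u μ lam n y f) (h₀ : IsCandidate l u f₀)
    (p₀ : PosLikelihood μ n y f₀) :
    lam * (psi f - psi f₀)
      ≤ ∑ i ∈ Finset.range n, (Real.log (conv f μ (y i)) - Real.log (conv f₀ μ (y i))) := by
  have := h.minimal f₀ h₀ p₀
  unfold objective at this
  rw [Finset.sum_sub_distrib]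
  linarith

variable [IsProbabilityMeasure μ]

lemma isBoundedOn_indicator_const (l u : ℝ) {a : ℝ} (ha : 0 ≤ a) :
    IsBoundedOn l u a ((Set.Icc l u).indicator fun _ => a) where
  measurable := measurable_const.indicator measurableSet_Icc
  nonneg x := Set.indicator_nonneg (fun _ _ => ha) x
  le _ := Set.indicator_apply_le' (fun _ => le_rfl) fun _ => ha
  eq_zero _ hx := Set.indicator_of_notMem hx _

lemma conv_le_mul_conv_indicator {A : ℝ} (hf : IsBoundedOn l u A f) (z : ℝ) :
    conv f μ z ≤ A * conv ((Set.Icc l u).indicator fun _ => 1) μ z := by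
  have hA := hf.bound_nonneg
  have h1 := conv_mono (μ := μ) hf (isBoundedOn_indicator_const l u hA) (fun x => by
    by_cases hx : x ∈ Set.Icc l u
    · simpa [hx] using hf.le x
    · simp [hx, hf.eq_zero x hx]) z
  refine h1.trans_eq ?_
  rw [conv, conv, ← integral_const_mul]
  congr 1
  ext e
  by_cases hx : z - e ∈ Set.Icc l u <;> simp [Set.indicator, hx]

/-- A first bound for the penalty of the estimate. Since `f * μ ≤ sup f · (1_[l,u] * μ)`,
the log-likelihood is at most `n log (sup f)` up to an error which does not depend on `f`. -/
lemma IsPMLE.penalty_le_of_indicator (hlu : l < u) (h : IsPMLE l u μ lam n y f)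
    (h₀ : IsCandidate l u f₀) (p₀ : PosLikelihood μ n y f₀) {b : ℝ}
    (hb : (∀ i < n, 0 < conv ((Set.Icc l u).indicator fun _ => 1) μ (y i)) →
      ∑ i ∈ Finset.range n, (Real.log (conv ((Set.Icc l u).indicator fun _ => 1) μ (y i))
        - Real.log (conv f₀ μ (y i))) ≤ b) :
    lam * (psi f - psi f₀) ≤ n * (√(psi f * (u - l)) * (u - l)) + b := by
  set A := √(psi f * (u - l)) * (u - l)
  set m := conv ((Set.Icc l u).indicator fun _ => 1) μ
  have hA := h.isCandidate.isBoundedOn hlu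
  have hm0 : ∀ z, 0 ≤ m z := conv_nonneg (isBoundedOn_indicator_const l u zero_le_one)
  have hle : ∀ z, conv f μ z ≤ A * m z := conv_le_mul_conv_indicator hA
  have hpos : ∀ i < n, 0 < A ∧ 0 < m (y i) := fun i hi => by
    have h1 := (h.posLikelihood i hi).trans_le (hle _)
    exact ⟨pos_of_mul_pos_left h1 (hm0 _), pos_of_mul_pos_right h1 hA.bound_nonneg⟩
  refine (h.penalty_le h₀ p₀).trans ?_
  have h2 : ∑ i ∈ Finset.range n, (Real.log (conv f μ (y i)) - Real.log (conv f₀ μ (y i)))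
      ≤ ∑ i ∈ Finset.range n, (A + (Real.log (m (y i)) - Real.log (conv f₀ μ (y i)))) := by
    refine Finset.sum_le_sum fun i hi => ?_
    obtain ⟨hA0, hmi⟩ := hpos i (Finset.mem_range.1 hi)
    have h3 := Real.log_le_log (h.posLikelihood i (Finset.mem_range.1 hi)) (hle (y i))
    rw [Real.log_mul hA0.ne' hmi.ne'] at h3
    have := Real.log_le_sub_one_of_pos hA0
    linarith
  refine h2.trans ?_
  rw [Finset.sum_add_distrib, Finset.sum_const, Finset.card_range, nsmul_eq_mul]
  have := hb fun i hi => (hpos i hi).2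
  linarith

/-- The main estimate for the penalty and the discrimination: the deviation inequality is applied
to a step function above the estimate. -/
lemma IsPMLE.penalty_add_discrimination_le (hlu : l < u) (h : IsPMLE l u μ lam n y f)
    (h₀ : IsCandidate l u f₀) (p₀ : PosLikelihood μ n y f₀) {η c : ℝ} {M : ℕ} (hη : 0 < η)
    (hM : 0 < M) (hAn : √(psi f * (u - l)) * (u - l) ≤ η * n)
    (hAM : √(psi f * (u - l)) * (u - l) ≤ η * M)
    (hdev : ∀ k : Fin (M + 1) → Fin (n + 1),
      (∀ i < n, 0 < conv (stepFun l u η k) μ (y i)) →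
      ∑ i ∈ Finset.range n, (Real.log (conv (stepFun l u η k) μ (y i))
          - Real.log (conv f₀ μ (y i)))
        < n * ((∫ z, conv (stepFun l u η k) μ z) - 1
            - discrimination (conv (stepFun l u η k) μ) (conv f₀ μ) / 2) + c) :
    ∃ H : ℝ → ℝ, Measurable H ∧ Integrable H ∧
      (∀ z, conv f μ z ≤ H z) ∧ (∀ z, H z ≤ conv f μ z + 3 * η) ∧
      lam * psi f + n * (discrimination H (conv f₀ μ) / 2)
        ≤ lam * psi f₀ + n * (3 * η * (u - l)) + c := by
  have hf := h.isCandidate.isBoundedOn hlu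
  obtain ⟨k, hk⟩ := exists_stepFun (n := n) hlu hη hM h.isCandidate.abs_sub_le hf.nonneg
    (fun x => (hf.le x).trans hAn) hAM
  have hs : IsBoundedOn l u (η * (n + 2)) (stepFun l u η k) := isBoundedOn_stepFun hη.le k
  have hlow : ∀ x, f x ≤ stepFun l u η k x := fun x => by
    by_cases hx : x ∈ Set.Icc l u
    · exact (hk x hx).1
    · rw [hf.eq_zero x hx]; exact hs.nonneg x
  have hup : ∀ x, stepFun l u η k x ≤ f x + 3 * η := fun x => by
    by_cases hx : x ∈ Set.Icc l u
    · exact (hk x hx).2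
    · rw [hs.eq_zero x hx]
      have := hf.nonneg x
      positivity
  have hH := conv_mono (μ := μ) hf hs hlow
  refine ⟨conv (stepFun l u η k) μ, measurable_conv hs.measurable, integrable_conv hs, hH,
    conv_le_conv_add hs hf hup, ?_⟩
  have hp : ∀ i < n, 0 < conv (stepFun l u η k) μ (y i) := fun i hi =>
    (h.posLikelihood i hi).trans_le (hH _)
  have h1 := h.penalty_le h₀ p₀
  have h2 : ∑ i ∈ Finset.range n, (Real.log (conv f μ (y i)) - Real.log (conv f₀ μ (y i)))
      ≤ ∑ i ∈ Finset.range n, (Real.log (conv (stepFun l u η k) μ (y i))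
          - Real.log (conv f₀ μ (y i))) := by
    refine Finset.sum_le_sum fun i hi => ?_
    have := Real.log_le_log (h.posLikelihood i (Finset.mem_range.1 hi)) (hH (y i))
    linarith
  have h3 := hdev k hp
  have hmass : ∫ z, conv (stepFun l u η k) μ z ≤ 1 + 3 * η * (u - l) := by
    have hc := isBoundedOn_indicator_const l u (by positivity : 0 ≤ 3 * η)
    rw [integral_conv hs]
    calc ∫ x, stepFun l u η k x
        ≤ ∫ x, (f x + (Set.Icc l u).indicator (fun _ => 3 * η) x) := by
          refine integral_mono hs.integrable (hf.integrable.add hc.integrable) fun x => ?_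
          by_cases hx : x ∈ Set.Icc l u
          · simpa [hx] using (hk x hx).2
          · simp [hx, hs.eq_zero x hx, hf.eq_zero x hx]
      _ = 1 + 3 * η * (u - l) := by
          rw [integral_add hf.integrable hc.integrable,
            h.isCandidate.isDensityOn.integral_eq_one, integral_indicator measurableSet_Icc]
          simp [hlu.le, mul_comm]
  have hn : (0 : ℝ) ≤ n := n.cast_nonneg
  nlinarith [mul_le_mul_of_nonneg_left hmass hn]

/-- A pointwise deviation of two Lipschitz functions is visible in the discrimination. -/
lemma pow_three_le_discrimination {v w H : ℝ → ℝ} {L B η s z : ℝ} (hL : 0 < L) (hs : 0 < s)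
    (hv : ∀ x y, |v x - v y| ≤ L * |x - y|) (hw : ∀ x y, |w x - w y| ≤ L * |x - y|)
    (hvH : ∀ y, v y ≤ H y) (hHv : ∀ y, H y ≤ v y + 3 * η) (mH : Measurable H) (iH : Integrable H)
    (mw : Measurable w) (iw : Integrable w) (hv0 : ∀ y, 0 ≤ v y) (hw0 : ∀ y, 0 ≤ w y)
    (hB : ∀ y, H y + w y ≤ B) (hη : 12 * η ≤ s) (hz : s ≤ |v z - w z|) :
    s ^ 3 / (64 * L * B) ≤ discrimination H w := by
  have hfar : ∀ y ∈ Set.Icc z (z + s / (4 * L)), s / 4 ≤ |H y - w y| := fun y hy => by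
    have h1 : L * |z - y| ≤ s / 4 := by
      rw [abs_sub_comm, abs_of_nonneg (by linarith [hy.1])]
      have : y - z ≤ s / (4 * L) := by linarith [hy.2]
      rw [le_div_iff₀ (by positivity)] at this
      linarith
    have h2 := abs_sub_le_iff.1 ((hv z y).trans h1)
    have h3 := abs_sub_le_iff.1 ((hw z y).trans h1)
    have h4 := hvH y
    have h5 := hHv y
    rcases le_abs.1 hz with h6 | h6
    · exact le_abs.2 (Or.inl (by linarith))
    · exact le_abs.2 (Or.inr (by linarith))
  have := le_discrimination iH iw mH mw (fun y => (hv0 y).trans (hvH y)) hw0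
    (r := s / (4 * L)) (s := s / 4) (by positivity) (by positivity) hB hfar
  refine le_trans (le_of_eq ?_) this
  rw [div_pow, div_div, div_mul_div_comm]
  congr 1 <;> ring

end Deterministic

/-! ### Orders of magnitude -/

section Asymptotics

variable {l u : ℝ}

lemma tendsto_rate (l u : ℝ) : Tendsto (rate l u) atTop (𝓝 0) := by
  have h1 : Tendsto (fun n : ℕ => Real.log n / n) atTop (𝓝 0) :=
    Real.isLittleO_log_id_atTop.tendsto_div_nhds_zero.comp tendsto_natCast_atTop_atTop
  have h2 : Tendsto (fun n : ℕ => (Real.log n / n) ^ (1 / 32 : ℝ) * |u - l| ^ (1 / 8 : ℝ)) atTop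
      (𝓝 0) := by
    have := (h1.rpow_const (p := (1 / 32 : ℝ)) (Or.inr (by norm_num))).mul_const
      (|u - l| ^ (1 / 8 : ℝ))
    rwa [Real.zero_rpow (by norm_num), zero_mul] at this
  refine h2.congr fun n => ?_
  rw [rate, Real.div_rpow (Real.log_natCast_nonneg n) n.cast_nonneg, Real.rpow_neg n.cast_nonneg]
  ring

lemma rate_pow (l u : ℝ) (n k : ℕ) : rate l u n ^ k
    = (n : ℝ) ^ (-(1 / 32) * k : ℝ) * |u - l| ^ (1 / 8 * k : ℝ)
      * Real.log n ^ (1 / 32 * k : ℝ) := by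
  rw [rate, mul_pow, mul_pow, ← Real.rpow_mul_natCast n.cast_nonneg,
    ← Real.rpow_mul_natCast (abs_nonneg _), ← Real.rpow_mul_natCast (Real.log_natCast_nonneg n)]

/-- The tuning parameter per observation is the fourth power of the rate. -/
lemma tuning_one_eq {n : ℕ} (hn : 0 < n) : tuning 1 l u n = n * rate l u n ^ 4 := by
  have hn' : (0 : ℝ) < n := by exact_mod_cast hn
  have h1 : (n : ℝ) ^ (7 / 8 : ℝ) = n * (n : ℝ) ^ (-(1 / 8) : ℝ) := by
    rw [← Real.rpow_one_add' hn'.le (by norm_num)]; norm_num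
  rw [tuning, rate_pow, Real.sqrt_eq_rpow, h1]
  norm_num
  ring

lemma le_rate_pow_four {n : ℕ} (hlu : l < u) (hlog : 1 ≤ Real.log n) :
    √(u - l) / (n : ℝ) ^ (1 / 8 : ℝ) ≤ rate l u n ^ 4 := by
  have h2 : (1 : ℝ) ≤ Real.log n ^ (1 / 8 : ℝ) := Real.one_le_rpow hlog (by norm_num)
  have h3 : rate l u n ^ 4
      = √(u - l) / (n : ℝ) ^ (1 / 8 : ℝ) * Real.log n ^ (1 / 8 : ℝ) := by
    have h4 : (n : ℝ) ^ (-(1 / 32) * (4 : ℕ) : ℝ) = ((n : ℝ) ^ (1 / 8 : ℝ))⁻¹ := by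
      rw [← Real.rpow_neg n.cast_nonneg]; norm_num
    have h5 : |u - l| ^ (1 / 8 * (4 : ℕ) : ℝ) = √(u - l) := by
      rw [abs_of_pos (sub_pos.2 hlu), Real.sqrt_eq_rpow]; norm_num
    have h6 : Real.log n ^ (1 / 32 * (4 : ℕ) : ℝ) = Real.log n ^ (1 / 8 : ℝ) := by norm_num
    rw [rate_pow, h4, h5, h6]
    ring
  rw [h3]
  exact le_mul_of_one_le_right (by positivity) h2

lemma rate_pos {n : ℕ} (hlu : l < u) (hn : 0 < n) (hlog : 1 ≤ Real.log n) : 0 < rate l u n := by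
  have hn' : (0 : ℝ) < n := by exact_mod_cast hn
  have h1 : 0 < |u - l| := abs_pos.2 (sub_pos.2 hlu).ne'
  have h2 : 0 < Real.log n := by linarith
  unfold rate
  positivity

lemma log_add_one_le_and_ceil_sqrt_le {w : ℝ} (hw : 2 ≤ w) {n : ℕ} (hn : (n : ℝ) = w ^ 8) :
    Real.log (n + 1) ≤ 9 * w ∧ (⌈√(n : ℝ)⌉₊ : ℝ) + 1 ≤ 3 * w ^ 4 ∧ w ^ 4 ≤ ⌈√(n : ℝ)⌉₊ := by
  have hw0 : 0 < w := by linarith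
  have hs : √(n : ℝ) = w ^ 4 := by
    rw [hn, show w ^ 8 = (w ^ 4) ^ 2 by ring, Real.sqrt_sq (by positivity)]
  have h4 : (1 : ℝ) ≤ w ^ 4 := one_le_pow₀ (by linarith)
  refine ⟨?_, ?_, ?_⟩
  · have h1 : (n : ℝ) + 1 ≤ 2 * w ^ 8 := by
      rw [hn]
      have : (1 : ℝ) ≤ w ^ 8 := one_le_pow₀ (by linarith)
      linarith
    have h2 := Real.log_le_log (by positivity) h1
    rw [Real.log_mul two_ne_zero (by positivity), Real.log_pow] at h2
    have h3 := Real.log_le_sub_one_of_pos hw0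
    have h5 := Real.log_le_sub_one_of_pos (two_pos : (0 : ℝ) < 2)
    push_cast at h2
    linarith
  · have := Nat.ceil_lt_add_one (Real.sqrt_nonneg (n : ℝ))
    rw [hs] at this ⊢
    linarith
  · rw [← hs]
    exact Nat.le_ceil _

/-- In the application `t = ψ(f)`, `a = ψ(fx)`, `ℓ = u - l`, and `A` is the resulting bound for
`sup f`. The hypothesis `h` is quadratic in `A` on the left and linear on the right. -/
lemma le_sq_of_mul_sub_le {ℓ w a ρ t A : ℝ} (hℓ : 0 < ℓ) (hw : 1 ≤ w) (ha : 0 ≤ a) (hA0 : 0 ≤ A)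
    (hA : A ^ 2 = t * ℓ ^ 3) (hρ : √ℓ / w ≤ ρ)
    (hK : ℓ ^ 3 + ℓ ^ 4 + √ℓ * a * ℓ ^ 3 ≤ w * √ℓ) (hK' : a * ℓ ^ 3 ≤ w)
    (h : ρ * (t - a) ≤ A + ℓ) : A ≤ w ^ 2 := by
  have hs : 0 < √ℓ := Real.sqrt_pos.2 hℓ
  by_contra! hlt
  have hw0 : 0 < w := by linarith
  have hA1 : 1 < A := lt_of_le_of_lt (one_le_pow₀ hw) hlt
  have hta : a < t := by
    by_contra! hta
    have h1 : A ^ 2 ≤ w := hA ▸ (mul_le_mul_of_nonneg_right hta (by positivity)).trans hK'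
    nlinarith
  have h1 : √ℓ / w * (t - a) ≤ A + ℓ :=
    (mul_le_mul_of_nonneg_right hρ (by linarith)).trans h
  rw [div_mul_eq_mul_div, div_le_iff₀ hw0] at h1
  -- the inequality multiplied by `ℓ³`, where `t ℓ³ = A²`
  have h2 : √ℓ * A ^ 2 ≤ w * ℓ ^ 3 * A + (w * ℓ ^ 4 + √ℓ * a * ℓ ^ 3) := by
    have := mul_le_mul_of_nonneg_right h1 (by positivity : 0 ≤ ℓ ^ 3)
    rw [hA]
    nlinarith
  have h3 : √ℓ * (w ^ 2 * A) < √ℓ * A ^ 2 := by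
    refine mul_lt_mul_of_pos_left ?_ hs
    nlinarith
  have h4 : (ℓ ^ 3 + ℓ ^ 4 + √ℓ * a * ℓ ^ 3) * (w * A) ≤ w * √ℓ * (w * A) := by gcongr
  have hp : 0 ≤ √ℓ * a * ℓ ^ 3 := by positivity
  have h5 : √ℓ * a * ℓ ^ 3 ≤ √ℓ * a * ℓ ^ 3 * (w * A) :=
    le_mul_of_one_le_right hp (by nlinarith)
  have h6 : w * ℓ ^ 4 ≤ w * ℓ ^ 4 * A := le_mul_of_one_le_right (by positivity) hA1.le
  nlinarith

/-- The errors from the mass of the step functions and from their number, which occur in the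
comparison, are absorbed by the tuning parameter. -/
lemma error_le {ℓ w ρ n M : ℝ} (hw : 2 ≤ w) (hn : n = w ^ 8)
    (hlog : Real.log (n + 1) ≤ 9 * w) (hM : M + 1 ≤ 3 * w ^ 4) (hρ : √ℓ / w ≤ ρ)
    (hK : 3 * ℓ + 90 ≤ w * √ℓ) :
    n * (3 * (w ^ 2)⁻¹ * ℓ) + (2 * ((M + 1) * Real.log (n + 1)) + 4 * Real.log (n + 1))
      ≤ n * ρ := by
  have hw1 : 1 ≤ w := by linarith
  have hw0 : 0 < w := by linarith
  have hn0 : 0 ≤ n := by rw [hn]; positivity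
  have e1 : n * (3 * (w ^ 2)⁻¹ * ℓ) = 3 * ℓ * w ^ 6 := by rw [hn]; field_simp
  have hlog0 : 0 ≤ Real.log (n + 1) := Real.log_nonneg (by linarith)
  have e2 : (M + 1) * Real.log (n + 1) ≤ 3 * w ^ 4 * (9 * w) := by gcongr
  have e3 : w ≤ w ^ 6 := le_self_pow₀ hw1 (by norm_num)
  have e4 : 3 * w ^ 4 * (9 * w) ≤ 27 * w ^ 6 := by
    have : w ^ 5 ≤ w ^ 6 := pow_le_pow_right₀ hw1 (by norm_num)
    linarith
  have e5 : (3 * ℓ + 90) * w ^ 6 ≤ w * √ℓ * w ^ 6 := by gcongr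
  have e6 : n * (√ℓ / w) ≤ n * ρ := by gcongr
  have e7 : n * (√ℓ / w) = w * √ℓ * w ^ 6 := by rw [hn]; field_simp
  rw [e7] at e6
  rw [e1]
  linarith

/-- The step height `w ^ (-2)` is negligible against the rate. -/
lemma height_le {ℓ w r : ℝ} (hℓ : 0 < ℓ) (hw : 0 < w) (hr : 0 < r) (h : √ℓ / w ≤ r ^ 4)
    (hr7 : 24 * r ^ 7 ≤ ℓ) : 12 * (w ^ 2)⁻¹ ≤ r / 2 := by
  have h1 : (√ℓ / w) ^ 2 ≤ (r ^ 4) ^ 2 := by gcongr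
  rw [div_pow, Real.sq_sqrt hℓ.le, div_eq_mul_inv] at h1
  have h2 : 24 * r ^ 7 * r ≤ ℓ * r := by gcongr
  have h3 : ℓ * (24 * (w ^ 2)⁻¹) ≤ ℓ * r := by linarith
  have := le_of_mul_le_mul_left h3 hℓ
  linarith

end Asymptotics

/-! ### The rate of convergence -/

section Rate

variable {l u : ℝ} {μ : Measure ℝ} [IsProbabilityMeasure μ] {n : ℕ} {y : ℕ → ℝ} {f₀ : ℝ → ℝ}

/-- Convergence in discrimination of candidates with bounded penalties implies uniform
convergence. -/
lemma supNorm_lt_of_discrimination_le (hlu : l < u) {f H : ℝ → ℝ} (hf : IsCandidate l u f)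
    (h₀ : IsCandidate l u f₀) (hψ : psi f ≤ psi f₀ + 1) {L B r η : ℝ}
    (hL : L = √((psi f₀ + 1) * (u - l))) (hB : B = 2 * (L * (u - l)) + 3) (hr0 : 0 < r)
    (hr : 1024 * L * B * (psi f₀ + 1) * r < 1) (mH : Measurable H) (iH : Integrable H)
    (hfH : ∀ z, conv f μ z ≤ H z) (hHf : ∀ z, H z ≤ conv f μ z + 3 * η) (hη1 : η ≤ 1)
    (hηr : 12 * η ≤ r / 2)
    (hΔ : discrimination H (conv f₀ μ) ≤ 2 * (r ^ 4 * (psi f₀ + 1))) :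
    supNorm (fun y => conv f μ y - conv f₀ μ y) < ENNReal.ofReal r := by
  have hℓ : 0 < u - l := sub_pos.2 hlu
  have hψ₀ : 0 ≤ psi f₀ := psi_nonneg _
  have hb := hf.isBoundedOn hlu
  have hb₀ := h₀.isBoundedOn hlu
  have hL0 : 0 < L := hL ▸ Real.sqrt_pos.2 (by positivity)
  have hLf : √(psi f * (u - l)) ≤ L := by rw [hL]; gcongr
  have hL₀ : √(psi f₀ * (u - l)) ≤ L := by rw [hL]; gcongr; linarith
  have hB0 : 0 < B := by rw [hB]; positivity
  have hBb : ∀ z, H z + conv f₀ μ z ≤ B := fun z => by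
    have h1 := hHf z
    have h2 := conv_le (μ := μ) hb z
    have h3 := conv_le (μ := μ) hb₀ z
    have h4 := mul_le_mul_of_nonneg_right hLf hℓ.le
    have h5 := mul_le_mul_of_nonneg_right hL₀ hℓ.le
    linarith
  have hlip : ∀ {g : ℝ → ℝ}, IsCandidate l u g → √(psi g * (u - l)) ≤ L → ∀ x y,
      |conv g μ x - conv g μ y| ≤ L * |x - y| := fun {g} hg hgL x y =>
    (abs_conv_sub_conv_le (hg.isBoundedOn hlu) hg.abs_sub_le x y).trans
      (mul_le_mul_of_nonneg_right hgL (abs_nonneg _))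
  have hpt : ∀ z, |conv f μ z - conv f₀ μ z| ≤ r / 2 := fun z => by
    by_contra! hz
    have h1 := pow_three_le_discrimination hL0 (half_pos hr0) (hlip hf hLf)
      (hlip h₀ hL₀) hfH hHf mH iH (measurable_conv hb₀.measurable) (integrable_conv hb₀)
      (conv_nonneg hb) (conv_nonneg hb₀) hBb hηr hz.le
    have h2 := h1.trans hΔ
    rw [div_le_iff₀ (by positivity)] at h2
    have h3 : 1024 * L * B * (psi f₀ + 1) * r * r ^ 3 < 1 * r ^ 3 := by gcongr
    linarith
  have hsup : supNorm (fun y => conv f μ y - conv f₀ μ y) ≤ ENNReal.ofReal (r / 2) :=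
    iSup_le fun z => by
      rw [Real.enorm_eq_ofReal_abs]
      exact ENNReal.ofReal_le_ofReal (hpt z)
  refine hsup.trans_lt ?_
  rw [ENNReal.ofReal_lt_ofReal_iff hr0]
  linarith

/-- For a fixed sample, the conclusion follows from the two deviation inequalities, provided that
`n = w ^ 8` is large in terms of `u - l` and `ψ(f₀)`. The step functions have about `√n = w ^ 4`
steps and take values in the multiples of `w ^ (-2)`. -/
lemma IsPMLE.supNorm_lt (hlu : l < u) {f : ℝ → ℝ}
    (h : IsPMLE l u μ (tuning 1 l u n) n y f) (h₀ : IsCandidate l u f₀)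
    (p₀ : PosLikelihood μ n y f₀) (hn0 : 0 < n) (hlog : 1 ≤ Real.log n) {w : ℝ} (hw : 2 ≤ w)
    (hwn : w = (n : ℝ) ^ (1 / 8 : ℝ))
    (hK1 : (u - l) ^ 3 + (u - l) ^ 4 + √(u - l) * psi f₀ * (u - l) ^ 3 ≤ w * √(u - l))
    (hK2 : psi f₀ * (u - l) ^ 3 ≤ w) (hK3 : 3 * (u - l) + 90 ≤ w * √(u - l))
    {L B : ℝ} (hL : L = √((psi f₀ + 1) * (u - l))) (hB : B = 2 * (L * (u - l)) + 3)
    (hr1 : 1024 * L * B * (psi f₀ + 1) * rate l u n < 1)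
    (hr2 : 24 * rate l u n ^ 7 ≤ u - l)
    (hdev1 : (∀ i < n, 0 < conv ((Set.Icc l u).indicator fun _ => 1) μ (y i)) →
      ∑ i ∈ Finset.range n, (Real.log (conv ((Set.Icc l u).indicator fun _ => 1) μ (y i))
          - Real.log (conv f₀ μ (y i)))
        ≤ n * ((u - l) - 1) + 4 * Real.log (n + 1))
    (hdev2 : ∀ k : Fin (⌈√(n : ℝ)⌉₊ + 1) → Fin (n + 1),
      (∀ i < n, 0 < conv (stepFun l u ((w ^ 2)⁻¹) k) μ (y i)) →
      ∑ i ∈ Finset.range n, (Real.log (conv (stepFun l u ((w ^ 2)⁻¹) k) μ (y i))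
          - Real.log (conv f₀ μ (y i)))
        < n * ((∫ z, conv (stepFun l u ((w ^ 2)⁻¹) k) μ z) - 1
            - discrimination (conv (stepFun l u ((w ^ 2)⁻¹) k) μ) (conv f₀ μ) / 2)
          + (2 * ((⌈√(n : ℝ)⌉₊ + 1) * Real.log (n + 1)) + 4 * Real.log (n + 1))) :
    supNorm (fun y => conv f μ y - conv f₀ μ y) < ENNReal.ofReal (rate l u n) := by
  set r := rate l u n
  set M := ⌈√(n : ℝ)⌉₊
  have hℓ : 0 < u - l := sub_pos.2 hlu
  have hw0 : 0 < w := by linarith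
  have hn' : (0 : ℝ) < n := by exact_mod_cast hn0
  have hnw : (n : ℝ) = w ^ 8 := by
    rw [hwn, ← Real.rpow_mul_natCast hn'.le]; norm_num
  obtain ⟨hlogw, hM1, hM2⟩ := log_add_one_le_and_ceil_sqrt_le hw hnw
  have hr0 : 0 < r := rate_pos hlu hn0 hlog
  have hr4 : √(u - l) / w ≤ r ^ 4 := hwn ▸ le_rate_pow_four hlu hlog
  have hlam : tuning 1 l u n = n * r ^ 4 := tuning_one_eq hn0
  have hψ₀ : 0 ≤ psi f₀ := psi_nonneg _
  have hψ : 0 ≤ psi f := psi_nonneg _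
  have hw1 : (1 : ℝ) ≤ w := by linarith
  -- the first bound for the penalty
  have hA : √(psi f * (u - l)) * (u - l) ≤ w ^ 2 := by
    refine le_sq_of_mul_sub_le (t := psi f) (a := psi f₀) hℓ hw1 hψ₀ (by positivity) ?_ hr4
      hK1 hK2 ?_
    · rw [mul_pow, Real.sq_sqrt (by positivity)]; ring
    · have h1 := h.penalty_le_of_indicator hlu h₀ p₀ (b := n * (u - l)) fun hp => by
        refine (hdev1 hp).trans ?_
        have h8 : 36 * w ≤ w ^ 8 := by
          have h7 : (36 : ℝ) ≤ w ^ 7 := by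
            have : (2 : ℝ) ^ 7 ≤ w ^ 7 := by gcongr
            linarith
          calc 36 * w ≤ w ^ 7 * w := by gcongr
            _ = w ^ 8 := by ring
        rw [mul_sub, mul_one]
        linarith
      rw [hlam, mul_assoc, ← mul_add] at h1
      exact le_of_mul_le_mul_left h1 hn'
  -- the comparison with a step function
  have hη0 : 0 < (w ^ 2)⁻¹ := by positivity
  have hηn : (w ^ 2)⁻¹ * n = w ^ 6 := by rw [hnw]; field_simp
  have hηM : w ^ 2 ≤ (w ^ 2)⁻¹ * M := by
    calc w ^ 2 = (w ^ 2)⁻¹ * w ^ 4 := by field_simp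
      _ ≤ _ := by gcongr
  have hM0 : 0 < M := by
    have : (0 : ℝ) < M := lt_of_lt_of_le (by positivity) hM2
    exact_mod_cast this
  obtain ⟨H, mH, iH, hfH, hHf, hmain⟩ := h.penalty_add_discrimination_le hlu h₀ p₀ hη0 hM0
    (hA.trans (hηn ▸ pow_le_pow_right₀ hw1 (by norm_num))) (hA.trans hηM) hdev2
  have hf := h.isCandidate.isBoundedOn hlu
  have hb₀ := h₀.isBoundedOn hlu
  set Δ := discrimination H (conv f₀ μ)
  have hΔ0 : 0 ≤ Δ := discrimination_nonneg (fun z => (conv_nonneg hf z).trans (hfH z))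
    (conv_nonneg hb₀)
  -- the error terms are absorbed by the tuning parameter
  have hrem := error_le hw hnw hlogw hM1 hr4 hK3
  rw [hlam] at hmain
  have hlam0 : 0 < n * r ^ 4 := by positivity
  have hψ1 : psi f ≤ psi f₀ + 1 := by
    have : 0 ≤ n * (Δ / 2) := by positivity
    refine le_of_mul_le_mul_left ?_ hlam0
    linarith
  have hΔ1 : Δ ≤ 2 * (r ^ 4 * (psi f₀ + 1)) := by
    have h1 : 0 ≤ n * r ^ 4 * psi f := by positivity
    have h2 : n * (Δ / 2) ≤ n * (r ^ 4 * (psi f₀ + 1)) := by linarith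
    have := le_of_mul_le_mul_left h2 hn'
    linarith
  exact supNorm_lt_of_discrimination_le hlu h.isCandidate h₀ hψ1 hL hB hr0 hr1 mH iH hfH hHf
    (inv_le_one_of_one_le₀ (one_le_pow₀ hw1)) (height_le hℓ hw0 hr0 hr4 hr2) hΔ1

end Rate

end Deconvolution

end

theorem mainTheorem1 :
    ∃ C₁ C₂ : ℝ → ℝ → ℝ, (∀ a b, 0 < C₁ a b) ∧ (∀ a b, 0 < C₂ a b) ∧
      ∀ (l u : ℝ), l < u →
      -- the true density, and the distribution of the error
      ∀ (fx : ℝ → ℝ), Deconvolution.IsDensityOn l u fx → ContDiffOn ℝ 2 fx (Set.Icc l u) →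
      ∀ (μ : Measure ℝ) [IsProbabilityMeasure μ],
      -- the sampling model: `Y j = X j + ε j`, with `X j` and `ε j` independent, i.i.d. in `j`
      ∀ {Ω : Type*} [MeasurableSpace Ω] (P : Measure Ω) [IsProbabilityMeasure P]
        (X ε Y : ℕ → Ω → ℝ),
        (∀ j, Measurable (X j)) → (∀ j, Measurable (ε j)) →
        iIndepFun (fun j ω => (X j ω, ε j ω)) P → (∀ j, IndepFun (X j) (ε j) P) →
        (∀ j, P.map (X j) = volume.withDensity (fun x => ENNReal.ofReal (fx x))) →
        (∀ j, P.map (ε j) = μ) →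
        (∀ j ω, Y j ω = X j ω + ε j ω) →
        ∀ᵐ ω ∂P, ∀ᶠ n : ℕ in atTop,
          (∃ f, Deconvolution.IsPMLE l u μ
            (Deconvolution.tuning
              (C₁ (Deconvolution.psi fx) (Deconvolution.psi (Deconvolution.conv fx μ))) l u n) n
            (fun j => Y j ω) f) ∧
          ∀ f, Deconvolution.IsPMLE l u μ
            (Deconvolution.tuning
              (C₁ (Deconvolution.psi fx) (Deconvolution.psi (Deconvolution.conv fx μ))) l u n) n
            (fun j => Y j ω) f →
          Deconvolution.supNorm
              (fun y => Deconvolution.conv f μ y - Deconvolution.conv fx μ y) <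
            ENNReal.ofReal
              (C₂ (Deconvolution.psi fx) (Deconvolution.psi (Deconvolution.conv fx μ)) *
                Deconvolution.rate l u n) := by
  open Deconvolution in
  refine ⟨fun _ _ => 1, fun _ _ => 1, fun _ _ => one_pos, fun _ _ => one_pos, ?_⟩
  intro l u hlu fx hfx hfx2 μ _ Ω _ P _ X ε Y mX mε hind hXε lX lε hY
  have hcand := isCandidate_of_contDiffOn hlu hfx hfx2
  have hb := hcand.isBoundedOn hlu
  have hℓ : 0 < u - l := sub_pos.2 hlu
  obtain rfl : Y = fun j ω => X j ω + ε j ω := by ext j ω; exact hY j ω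
  have mY : ∀ j, Measurable fun ω => X j ω + ε j ω := fun j => (mX j).add (mε j)
  have indY : iIndepFun (fun j ω => X j ω + ε j ω) P :=
    hind.comp (fun _ p => p.1 + p.2) fun _ => measurable_fst.add measurable_snd
  have law := fun j => map_add_eq_withDensity_conv hb (mX j) (mε j) (hXε j) (lX j) (lε j)
  have mg : Measurable (conv fx μ) := measurable_conv hb.measurable
  have ig : Integrable (conv fx μ) := integrable_conv hb
  have g0 : ∀ y, 0 ≤ conv fx μ y := conv_nonneg hb
  have g1 : ∫ y, conv fx μ y = 1 := (integral_conv hb).trans hfx.integral_eq_one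
  have hm := isBoundedOn_indicator_const l u zero_le_one
  have hm1 : ∫ y, conv ((Set.Icc l u).indicator fun _ => 1) μ y = u - l := by
    rw [integral_conv hm, integral_indicator measurableSet_Icc]
    simp [hlu.le]
  set η : ℕ → ℝ := fun n => (((n : ℝ) ^ (1 / 8 : ℝ)) ^ 2)⁻¹
  have hstep := fun (n : ℕ) (k : Fin (⌈√(n : ℝ)⌉₊ + 1) → Fin (n + 1)) =>
    isBoundedOn_stepFun (l := l) (u := u) (η := η n) (by positivity) k
  -- the deviation inequality for the convolved indicator function, and for all step functions
  have dev1 := ae_eventually_sum_log_lt mY indY mg ig g0 g1 law (K := fun _ => Unit)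
    (H := fun _ _ => conv ((Set.Icc l u).indicator fun _ => 1) μ)
    (fun _ _ => measurable_conv hm.measurable) (fun _ _ => integrable_conv hm)
    (fun _ _ => conv_nonneg hm) (N := fun _ => 0) (by simp)
  have dev2 := ae_eventually_sum_log_lt mY indY mg ig g0 g1 law
    (K := fun n => Fin (⌈√(n : ℝ)⌉₊ + 1) → Fin (n + 1))
    (H := fun n k => conv (stepFun l u (η n) k) μ)
    (fun n k => measurable_conv (hstep n k).measurable) (fun n k => integrable_conv (hstep n k))
    (fun n k => conv_nonneg (hstep n k)) (fun n => card_stepFun_index)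
  filter_upwards [dev1, dev2, ae_all_iff.2 fun j => ae_density_pos mg (mY j) (law j)]
    with ω h1 h2 hpos
  have hwlim : Tendsto (fun n : ℕ => (n : ℝ) ^ (1 / 8 : ℝ)) atTop atTop :=
    (tendsto_rpow_atTop (by norm_num)).comp tendsto_natCast_atTop_atTop
  have hwslim : Tendsto (fun n : ℕ => (n : ℝ) ^ (1 / 8 : ℝ) * √(u - l)) atTop atTop :=
    hwlim.atTop_mul_const (Real.sqrt_pos.2 hℓ)
  have hloglim : Tendsto (fun n : ℕ => Real.log n) atTop atTop :=
    Real.tendsto_log_atTop.comp tendsto_natCast_atTop_atTop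
  have hrlim := tendsto_rate l u
  set L := √((psi fx + 1) * (u - l))
  set B := 2 * (L * (u - l)) + 3
  have hr1 : ∀ᶠ n : ℕ in atTop, 1024 * L * B * (psi fx + 1) * rate l u n < 1 := by
    have := hrlim.const_mul (1024 * L * B * (psi fx + 1))
    rw [mul_zero] at this
    exact this.eventually_lt_const one_pos
  have hr2 : ∀ᶠ n : ℕ in atTop, 24 * rate l u n ^ 7 ≤ u - l := by
    have := (hrlim.pow 7).const_mul 24
    rw [zero_pow (by norm_num), mul_zero] at this
    exact this.eventually_le_const hℓ
  filter_upwards [h1, h2, hr1, hr2, eventually_gt_atTop 0, hloglim.eventually_ge_atTop 1,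
    hwlim.eventually_ge_atTop 2, hwlim.eventually_ge_atTop (psi fx * (u - l) ^ 3),
    hwslim.eventually_ge_atTop (3 * (u - l) + 90), hwslim.eventually_ge_atTop
      ((u - l) ^ 3 + (u - l) ^ 4 + √(u - l) * psi fx * (u - l) ^ 3)]
    with n d1 d2 hr1 hr2 hn hlog hw hK2 hK3 hK1
  have p₀ : PosLikelihood μ n (fun j => X j ω + ε j ω) fx := fun i _ => hpos i
  refine ⟨exists_isPMLE hlu ?_ hcand p₀, fun f hf => ?_⟩
  · rw [tuning_one_eq hn]
    have := rate_pos hlu hn hlog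
    have hn' : (0 : ℝ) < n := by exact_mod_cast hn
    positivity
  · rw [one_mul]
    refine hf.supNorm_lt hlu hcand p₀ hn hlog hw rfl hK1 hK2 hK3 rfl rfl hr1 hr2 ?_ ?_
    · refine fun hp => (d1 () hp).le.trans ?_
      have h0 := discrimination_nonneg (conv_nonneg (μ := μ) hm) g0
      have hn' : (0 : ℝ) < n := by exact_mod_cast hn
      rw [hm1, mul_zero, add_zero]
      exact add_le_add_left (mul_le_mul_of_nonneg_left (by linarith) hn'.le) _
    · intro k hk
      rw [← add_assoc]
      exact d2 k hk
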